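/- Let $\ell$ be a prime and let $G$ be a (topologically) finitely generated pro-$\ell$ group whose abelianization $G^{\mathrm{ab}}$ (the quotient by the closure of the commutator subgroup) is torsion-free. Let $\mathbb{Z}_\ell[[G]]=\varprojlim_N\mathbb{Z}_\ell[G/N]$ be the completed group ring, $\mathscr I$ its augmentation ideal, $V=\mathscr I/\mathscr I^2$ and $U=\mathscr I^2/\mathscr I^3$. Let $\operatorname{Aut}(G)$ be the group of continuous automorphisms of $G$ with its profinite (compact-open) topology, acting on all these objects, and let $\operatorname{Out}(G)$ be its quotient by the inner automorphisms. All $H^1$ are continuous cohomology groups. Let $\mathrm{MD}_{\mathrm{univ}}\in H^1(\operatorname{Aut}(G),\operatorname{Hom}(V,U))$ be the class of the extension $0\to\mathscr I^2/\mathscr I^3\to\mathscr I/\mathscr I^3\to\mathscr I/\mathscr I^2\to 0$, i.e. the class of the cocycle $\sigma\mapsto \sigma\circ s\circ\sigma^{-1}-s$ for any $\mathbb{Z}_\ell$-linear section $s$ of $\mathscr I/\mathscr I^3\to\mathscr I/\mathscr I^2$. Let $m:V\to\operatorname{Hom}(V,U)$, $x\mapsto(y\mapsto xy-yx)$, be the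 commutator map and $A(G)=\operatorname{coker}(m)$; inner automorphisms act trivially on $\operatorname{Hom}(V,U)$ and on $A(G)$. Let $J_{\mathrm{univ}}\in H^1(\operatorname{Out}(G),A(G))$ be the unique class whose inflation to $H^1(\operatorname{Aut}(G),A(G))$ is the image of $\mathrm{MD}_{\mathrm{univ}}$. Let $\operatorname{Alt}^2V\subset V\otimes_{\mathbb{Z}_\ell} V$ be the submodule of tensors on which the swap $v_1\otimes v_2\mapsto v_2\otimes v_1$ acts as $-1$, let $W\subset U$ be the image of $\operatorname{Alt}^2V$ under multiplication $V\otimes V\to U$, and let $A_W(G)=\operatorname{coker}(m:V\to\operatorname{Hom}(V,W))$ (the image of $m$ lies in $\operatorname{Hom}(V,W)$). The classes $\mathrm{MD}_{\mathrm{univ}}$ and $J_{\mathrm{univ}}$ exist and are unique. Suppose that some $\sigma\in\operatorname{Aut}(G)$ acts on $G^{\mathrm{ab}}$ as multiplication by $-1$. Then: 1. The class $4\,\mathrm{MD}_{\mathrm{univ}}$ lies in the image of the natural map $H^1(\operatorname{Aut}(G),\operatorname{Hom}(V,W))\to H^1(\operatorname{Aut}(G),\operatorname{Hom}(V,U))$.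 If moreover $H^0(\operatorname{Aut}(G),\operatorname{Hom}(V,U)\otimes\mathbb{Z}_\ell/2)=0$, then $2\,\mathrm{MD}_{\mathrm{univ}}$ has a unique preimage under this map. 2. The class $4J_{\mathrm{univ}}$ lies in the image of the natural map $H^1(\operatorname{Out}(G),A_W(G))\to H^1(\operatorname{Out}(G),A(G))$. If moreover $H^0(\operatorname{Out}(G),\operatorname{Hom}(V,U)\otimes\mathbb{Z}_\ell/2)=0$, then $2J_{\mathrm{univ}}$ has a unique preimage under this map. -/

import Mathlib

open scoped TensorProduct

universe u

namespace ProEll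

/-! ### Automorphisms and outer automorphisms of a topological group -/

section Automorphisms

/-- `Aut(G)`: the automorphisms of the topological group `G` (bicontinuous group automorphisms). -/
def ContAut (G : Type u) [Group G] [TopologicalSpace G] : Type u := G ≃ₜ* G

variable {G : Type u} [Group G] [TopologicalSpace G]

instance : EquivLike (ContAut G) G G := inferInstanceAs (EquivLike (G ≃ₜ* G) G G)

instance : MulEquivClass (ContAut G) G G := inferInstanceAs (MulEquivClass (G ≃ₜ* G) G G)

theorem ContAut.continuous (σ : ContAut G) : Continuous σ :=
  ContinuousMulEquiv.continuous_toFun σ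

theorem ContAut.ext {σ τ : ContAut G} (h : ∀ g, σ g = τ g) : σ = τ := DFunLike.ext σ τ h

/-- The group structure is composition: `(σ * τ) g = σ (τ g)`. -/
instance : Group (ContAut G) where
  mul σ τ := ContinuousMulEquiv.trans τ σ
  one := ContinuousMulEquiv.refl G
  inv σ := ContinuousMulEquiv.symm σ
  mul_assoc _ _ _ := rfl
  one_mul _ := rfl
  mul_one _ := rfl
  inv_mul_cancel σ := ContAut.ext fun g => ContinuousMulEquiv.symm_apply_apply σ g

theorem ContAut.mul_apply (σ τ : ContAut G) (g : G) : (σ * τ) g = σ (τ g) := rfl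

theorem ContAut.one_apply (g : G) : (1 : ContAut G) g = g := rfl

theorem ContAut.apply_inv_apply (σ : ContAut G) (g : G) : σ (σ⁻¹ g) = g := by
  rw [← ContAut.mul_apply, mul_inv_cancel, ContAut.one_apply]

/-- The compact-open topology on `Aut(G)`. For `G` profinite this is the topology of uniform
convergence: `σ` and `τ` are close if they agree modulo a small open normal subgroup. -/
instance : TopologicalSpace (ContAut G) :=
  TopologicalSpace.induced (fun σ => (⟨σ, σ.continuous⟩ : C(G, G))) inferInstance

variable [IsTopologicalGroup G]

/-- The map `G → Aut(G)`, `g ↦ (x ↦ g x g⁻¹)`. -/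
def conj : G →* ContAut G where
  toFun g :=
    { MulAut.conj g with
      continuous_toFun := by
        change Continuous fun x => g * x * g⁻¹
        fun_prop
      continuous_invFun := by
        change Continuous fun x => g⁻¹ * x * g
        fun_prop }
  map_one' := ContAut.ext fun x => by
    change 1 * x * 1⁻¹ = x
    simp
  map_mul' g h := ContAut.ext fun x => by
    change g * h * x * (g * h)⁻¹ = g * (h * x * h⁻¹) * g⁻¹
    group

theorem conj_apply (g x : G) : conj g x = g * x * g⁻¹ := rfl

variable (G) in
/-- The inner automorphisms of `G`. -/
def Inn : Subgroup (ContAut G) := (conj (G := G)).range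

instance : (Inn G).Normal where
  conj_mem := by
    rintro _ ⟨g, rfl⟩ σ
    refine ⟨σ g, ContAut.ext fun x => ?_⟩
    simp only [ContAut.mul_apply, conj_apply, map_mul, map_inv, ContAut.apply_inv_apply]

variable (G) in
/-- `Out(G) = Aut(G) / Inn(G)`, with the quotient topology. -/
abbrev ContOut : Type u := ContAut G ⧸ Inn G

end Automorphisms

/-! ### The completed group ring `ℤ_ℓ[[G]]` -/

section CompletedGroupRing

variable (ℓ : ℕ) [Fact ℓ.Prime]
variable {G : Type u} [Group G] [TopologicalSpace G]

/-- The map `ℤ_ℓ[G/N] → ℤ_ℓ[G/M]` induced by an endomorphism `φ` of `G` carrying `N` into `M`. -/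
noncomputable def transition (φ : G →* G) {N M : OpenNormalSubgroup G}
    (h : ∀ g ∈ N.toSubgroup, φ g ∈ M.toSubgroup) :
    MonoidAlgebra ℤ_[ℓ] (G ⧸ N.toSubgroup) →ₐ[ℤ_[ℓ]] MonoidAlgebra ℤ_[ℓ] (G ⧸ M.toSubgroup) :=
  MonoidAlgebra.mapDomainAlgHom ℤ_[ℓ] ℤ_[ℓ]
    (QuotientGroup.map N.toSubgroup M.toSubgroup φ h)

theorem transition_single (φ : G →* G) {N M : OpenNormalSubgroup G}
    (h : ∀ g ∈ N.toSubgroup, φ g ∈ M.toSubgroup) (g : G) (a : ℤ_[ℓ]) :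
    transition ℓ φ h (MonoidAlgebra.single (g : G ⧸ N.toSubgroup) a) =
      MonoidAlgebra.single (φ g : G ⧸ M.toSubgroup) a := by
  simp only [transition, MonoidAlgebra.mapDomainAlgHom_apply, MonoidAlgebra.mapDomain_single]
  rfl

theorem transition_transition (φ ψ : G →* G) {N M L : OpenNormalSubgroup G}
    (h : ∀ g ∈ N.toSubgroup, φ g ∈ M.toSubgroup) (h' : ∀ g ∈ M.toSubgroup, ψ g ∈ L.toSubgroup)
    (h'' : ∀ g ∈ N.toSubgroup, (ψ.comp φ) g ∈ L.toSubgroup)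
    (x : MonoidAlgebra ℤ_[ℓ] (G ⧸ N.toSubgroup)) :
    transition ℓ ψ h' (transition ℓ φ h x) = transition ℓ (ψ.comp φ) h'' x := by
  rw [← AlgHom.comp_apply]
  simp only [transition, ← MonoidAlgebra.mapDomainAlgHom_comp]
  congr 2
  ext g
  rfl

variable (G) in
/-- The compatible families in `∏_N ℤ_ℓ[G/N]`, `N` ranging over the open normal subgroups. -/
noncomputable def compatibleFamilies :
    Subalgebra ℤ_[ℓ] (∀ N : OpenNormalSubgroup G, MonoidAlgebra ℤ_[ℓ] (G ⧸ N.toSubgroup)) where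
  carrier := {f | ∀ (N M : OpenNormalSubgroup G)
    (h : ∀ g ∈ N.toSubgroup, MonoidHom.id G g ∈ M.toSubgroup),
    transition ℓ (MonoidHom.id G) h (f N) = f M}
  mul_mem' hf hg N M h := by simp [hf N M h, hg N M h]
  add_mem' hf hg N M h := by simp [hf N M h, hg N M h]
  algebraMap_mem' r N M h := by
    rw [Pi.algebraMap_apply, Pi.algebraMap_apply, AlgHom.commutes]

variable (G) in
/-- The completed group ring `ℤ_ℓ[[G]] = lim ℤ_ℓ[G/N]`, `N` ranging over the open normal
subgroups of `G`. -/
def CompletedGroupRing : Type u := compatibleFamilies ℓ G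

noncomputable instance : Ring (CompletedGroupRing ℓ G) :=
  inferInstanceAs (Ring (compatibleFamilies ℓ G))

noncomputable instance : Algebra ℤ_[ℓ] (CompletedGroupRing ℓ G) :=
  inferInstanceAs (Algebra ℤ_[ℓ] (compatibleFamilies ℓ G))

variable {ℓ}

namespace CompletedGroupRing

variable (ℓ) in
/-- The projection `ℤ_ℓ[[G]] → ℤ_ℓ[G/N]`. -/
noncomputable def proj (N : OpenNormalSubgroup G) :
    CompletedGroupRing ℓ G →ₐ[ℤ_[ℓ]] MonoidAlgebra ℤ_[ℓ] (G ⧸ N.toSubgroup) :=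
  (Pi.evalAlgHom ℤ_[ℓ] _ N).comp (compatibleFamilies ℓ G).val

theorem ext {x y : CompletedGroupRing ℓ G} (h : ∀ N, proj ℓ N x = proj ℓ N y) : x = y :=
  Subtype.ext (funext h)

theorem transition_proj (x : CompletedGroupRing ℓ G) {N M : OpenNormalSubgroup G}
    (h : ∀ g ∈ N.toSubgroup, MonoidHom.id G g ∈ M.toSubgroup) :
    transition ℓ (MonoidHom.id G) h (proj ℓ N x) = proj ℓ M x :=
  x.2 N M h

/-- The inverse limit topology, each `ℤ_ℓ[G/N]` having the product topology of the coefficients. -/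
noncomputable instance : TopologicalSpace (CompletedGroupRing ℓ G) :=
  TopologicalSpace.induced
    (fun x (N : OpenNormalSubgroup G) (q : G ⧸ N.toSubgroup) => (proj ℓ N x).coeff q) inferInstance

/-- The coefficients of an element, as an additive map. -/
noncomputable def coeffHom : CompletedGroupRing ℓ G →+
    (∀ N : OpenNormalSubgroup G, G ⧸ N.toSubgroup → ℤ_[ℓ]) where
  toFun x N q := (proj ℓ N x).coeff q
  map_zero' := by
    ext N q
    simp
  map_add' x y := by
    ext N q
    simp

instance : IsTopologicalAddGroup (CompletedGroupRing ℓ G) :=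
  topologicalAddGroup_induced (coeffHom (ℓ := ℓ) (G := G))

variable (ℓ) in
/-- The element `[g]` of `ℤ_ℓ[[G]]`. -/
noncomputable def of : G →* CompletedGroupRing ℓ G where
  toFun g := ⟨fun N => MonoidAlgebra.single (g : G ⧸ N.toSubgroup) 1, fun _ _ h =>
    transition_single ℓ _ h g 1⟩
  map_one' := rfl
  map_mul' g h := ext fun N => by
    change MonoidAlgebra.single ((g * h : G) : G ⧸ N.toSubgroup) (1 : ℤ_[ℓ]) = MonoidAlgebra.single (g : G ⧸ N.toSubgroup) (1 : ℤ_[ℓ]) * MonoidAlgebra.single (h : G ⧸ N.toSubgroup) 1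
    rw [MonoidAlgebra.single_mul_single, one_mul]
    rfl

theorem proj_of (g : G) (N : OpenNormalSubgroup G) :
    proj ℓ N (of ℓ g) = MonoidAlgebra.single (g : G ⧸ N.toSubgroup) 1 := rfl

/-- The inverse image of an open normal subgroup under an automorphism. -/
def pullback (σ : ContAut G) (N : OpenNormalSubgroup G) : OpenNormalSubgroup G where
  toOpenSubgroup := N.toOpenSubgroup.comap (σ : G →* G) σ.continuous
  isNormal' := Subgroup.Normal.comap N.isNormal' (σ : G →* G)

theorem pullback_le (σ : ContAut G) (N : OpenNormalSubgroup G) :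
    ∀ g ∈ (pullback σ N).toSubgroup, (σ : G →* G) g ∈ N.toSubgroup := fun _ h => h

/-- The action of an automorphism `σ` on `ℤ_ℓ[[G]]`, characterised by `[g] ↦ [σ g]` and
compatibility with the limit. -/
noncomputable def map (σ : ContAut G) : CompletedGroupRing ℓ G →ₐ[ℤ_[ℓ]] CompletedGroupRing ℓ G :=
  AlgHom.codRestrict
    (AlgHom.pi fun N => (transition ℓ (σ : G →* G) (pullback_le σ N)).comp
      (proj ℓ (pullback σ N)))
    (compatibleFamilies ℓ G) (by
      intro x N M h
      have h1 : ∀ g ∈ (pullback σ N).toSubgroup, MonoidHom.id G g ∈ (pullback σ M).toSubgroup :=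
        fun _ hg => h _ hg
      have h2 : ∀ g ∈ (pullback σ N).toSubgroup, (σ : G →* G) g ∈ M.toSubgroup :=
        fun _ hg => h _ hg
      change transition ℓ (MonoidHom.id G) h
        (transition ℓ (σ : G →* G) (pullback_le σ N) (proj ℓ (pullback σ N) x)) =
        transition ℓ (σ : G →* G) (pullback_le σ M) (proj ℓ (pullback σ M) x)
      rw [← transition_proj x h1, transition_transition ℓ _ _ _ _ h2,
        transition_transition ℓ _ _ _ _ h2]
      rfl)

theorem proj_map (σ : ContAut G) (x : CompletedGroupRing ℓ G) (N : OpenNormalSubgroup G) :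
    proj ℓ N (map σ x) =
      transition ℓ (σ : G →* G) (pullback_le σ N) (proj ℓ (pullback σ N) x) := rfl

theorem map_of (σ : ContAut G) (g : G) : map σ (of ℓ g) = of ℓ (σ g) :=
  ext fun N => by
    rw [proj_map, proj_of, transition_single, proj_of]
    rfl

theorem map_one_apply (x : CompletedGroupRing ℓ G) : map (1 : ContAut G) x = x :=
  ext fun N => transition_proj x (pullback_le (1 : ContAut G) N)

theorem map_mul_apply (σ τ : ContAut G) (x : CompletedGroupRing ℓ G) :
    map (σ * τ) x = map σ (map τ x) :=
  ext fun N => by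
    rw [proj_map, proj_map, proj_map, transition_transition ℓ _ _ _ _ (fun _ h => h)]
    rfl

/-- An inner automorphism acts on `ℤ_ℓ[[G]]` as `x ↦ [g] x [g⁻¹]`. -/
theorem map_conj [IsTopologicalGroup G] (g : G) (x : CompletedGroupRing ℓ G) :
    map (conj g) x = of ℓ g * x * of ℓ g⁻¹ := by
  refine ext fun N => ?_
  have h : ∀ y ∈ (pullback (conj g) N).toSubgroup, MonoidHom.id G y ∈ N.toSubgroup := by
    intro y hy
    change y ∈ N.toSubgroup
    have h1 : g * y * g⁻¹ ∈ N.toSubgroup := hy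
    have h2 := N.isNormal'.conj_mem _ h1 g⁻¹
    have h3 : g⁻¹ * (g * y * g⁻¹) * g⁻¹⁻¹ = y := by group
    rwa [h3] at h2
  rw [proj_map, map_mul, map_mul, proj_of, proj_of, ← transition_proj x h]
  induction proj ℓ (pullback (conj g) N) x using MonoidAlgebra.induction_linear with
  | zero => simp
  | add a b ha hb => rw [map_add, map_add, ha, hb, mul_add, add_mul]
  | single q a =>
    induction q using QuotientGroup.induction_on with
    | H y =>
      rw [transition_single, transition_single, MonoidAlgebra.single_mul_single,
        MonoidAlgebra.single_mul_single, one_mul, mul_one]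
      rfl

end CompletedGroupRing

end CompletedGroupRing

/-! ### The augmentation ideal, its powers, and their subquotients -/

section Augmentation

open CompletedGroupRing

variable (ℓ : ℕ) [Fact ℓ.Prime]
variable (G : Type u) [Group G] [TopologicalSpace G]

/-- The whole group, as an open normal subgroup. -/
def wholeGroup : OpenNormalSubgroup G where
  toOpenSubgroup := ⊤
  isNormal' := (inferInstance : (⊤ : Subgroup G).Normal)

/-- The augmentation `ℤ_ℓ[[G]] → ℤ_ℓ[G/G] → ℤ_ℓ`. -/
noncomputable def augmentation : CompletedGroupRing ℓ G →ₐ[ℤ_[ℓ]] ℤ_[ℓ] :=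
  (MonoidAlgebra.lift ℤ_[ℓ] ℤ_[ℓ] (G ⧸ (wholeGroup G).toSubgroup) 1).comp (proj ℓ (wholeGroup G))

/-- The augmentation ideal `I` of `ℤ_ℓ[[G]]`, as a `ℤ_ℓ`-submodule. -/
noncomputable def augIdeal : Submodule ℤ_[ℓ] (CompletedGroupRing ℓ G) :=
  LinearMap.ker (augmentation ℓ G).toLinearMap

variable {ℓ G}

theorem lift_transition (φ : G →* G) {N M : OpenNormalSubgroup G}
    (h : ∀ g ∈ N.toSubgroup, φ g ∈ M.toSubgroup)
    (x : MonoidAlgebra ℤ_[ℓ] (G ⧸ N.toSubgroup)) :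
    MonoidAlgebra.lift ℤ_[ℓ] ℤ_[ℓ] (G ⧸ M.toSubgroup) 1 (transition ℓ φ h x) =
      MonoidAlgebra.lift ℤ_[ℓ] ℤ_[ℓ] (G ⧸ N.toSubgroup) 1 x := by
  induction x using MonoidAlgebra.induction_linear with
  | zero => simp
  | add a b ha hb => rw [map_add, map_add, map_add, ha, hb]
  | single q a =>
    induction q using QuotientGroup.induction_on with
    | H y => simp [transition_single]

theorem augmentation_map (σ : ContAut G) (x : CompletedGroupRing ℓ G) :
    augmentation ℓ G (CompletedGroupRing.map σ x) = augmentation ℓ G x := by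
  have h : ∀ g ∈ (pullback σ (wholeGroup G)).toSubgroup,
      MonoidHom.id G g ∈ (wholeGroup G).toSubgroup := fun _ _ => trivial
  simp only [augmentation, AlgHom.comp_apply]
  rw [proj_map, lift_transition, ← transition_proj x h, lift_transition]

theorem augmentation_of (g : G) : augmentation ℓ G (of ℓ g) = 1 := by
  simp only [augmentation, AlgHom.comp_apply]
  rw [proj_of]
  simp

theorem of_sub_one_mem (g : G) : of ℓ g - 1 ∈ augIdeal ℓ G := by
  change augmentation ℓ G (of ℓ g - 1) = 0
  rw [map_sub, augmentation_of, map_one, sub_self]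

theorem augIdeal_sq_le : augIdeal ℓ G ^ 2 ≤ augIdeal ℓ G := by
  rw [pow_two, Submodule.mul_le]
  intro x hx y _
  change augmentation ℓ G (x * y) = 0
  have hx0 : augmentation ℓ G x = 0 := hx
  rw [map_mul, hx0, zero_mul]

theorem augIdeal_pow_succ_le (n : ℕ) : augIdeal ℓ G ^ (n + 2) ≤ augIdeal ℓ G ^ (n + 1) := by
  rw [pow_add, pow_add, pow_one]
  exact mul_le_mul_right augIdeal_sq_le _

theorem augIdeal_pow_map_le (σ : ContAut G) (n : ℕ) :
    augIdeal ℓ G ^ n ≤ (augIdeal ℓ G ^ n).comap (CompletedGroupRing.map σ).toLinearMap := by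
  rw [← Submodule.map_le_iff_le_comap, Submodule.map_pow]
  refine pow_le_pow_left' ?_ n
  rintro _ ⟨x, hx, rfl⟩
  exact (augmentation_map σ x).trans hx

variable (ℓ G)

/-- The subquotient `I^m / I^n` of `ℤ_ℓ[[G]]` (used for `n ≥ m ≥ 1`).
The power `I^m` is the `ℤ_ℓ`-span of the `m`-fold products of elements of `I`; as `I` is a two-sided
ideal, this is the usual power of the ideal. -/
def AugQuot (m n : ℕ) : Type u :=
  ↥(augIdeal ℓ G ^ m) ⧸ (augIdeal ℓ G ^ n).submoduleOf (augIdeal ℓ G ^ m)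

noncomputable instance (m n : ℕ) : AddCommGroup (AugQuot ℓ G m n) :=
  inferInstanceAs (AddCommGroup (↥(augIdeal ℓ G ^ m) ⧸
    (augIdeal ℓ G ^ n).submoduleOf (augIdeal ℓ G ^ m)))

noncomputable instance (m n : ℕ) : Module ℤ_[ℓ] (AugQuot ℓ G m n) :=
  inferInstanceAs (Module ℤ_[ℓ] (↥(augIdeal ℓ G ^ m) ⧸
    (augIdeal ℓ G ^ n).submoduleOf (augIdeal ℓ G ^ m)))

/-- The quotient of the subspace topology. -/
noncomputable instance (m n : ℕ) : TopologicalSpace (AugQuot ℓ G m n) :=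
  inferInstanceAs (TopologicalSpace (↥(augIdeal ℓ G ^ m) ⧸
    (augIdeal ℓ G ^ n).submoduleOf (augIdeal ℓ G ^ m)))

instance (m n : ℕ) : IsTopologicalAddGroup (AugQuot ℓ G m n) :=
  inferInstanceAs (IsTopologicalAddGroup (↥(augIdeal ℓ G ^ m) ⧸
    (augIdeal ℓ G ^ n).submoduleOf (augIdeal ℓ G ^ m)))

/-- The quotient map `I^m → I^m / I^n`. -/
noncomputable def AugQuot.mk (m n : ℕ) : ↥(augIdeal ℓ G ^ m) →ₗ[ℤ_[ℓ]] AugQuot ℓ G m n :=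
  Submodule.mkQ _

variable {ℓ G} in
theorem AugQuot.mk_surjective {m n : ℕ} : Function.Surjective (AugQuot.mk ℓ G m n) :=
  Submodule.mkQ_surjective _

variable {ℓ G} in
theorem AugQuot.mk_eq_zero {m n : ℕ} {x : ↥(augIdeal ℓ G ^ m)} :
    AugQuot.mk ℓ G m n x = 0 ↔ x.1 ∈ augIdeal ℓ G ^ n :=
  Submodule.Quotient.mk_eq_zero _

variable {ℓ G} in
/-- A linear map on `I^m` that vanishes on `I^n` factors through `I^m / I^n`. -/
noncomputable def AugQuot.lift {m n : ℕ} {M : Type*} [AddCommGroup M] [Module ℤ_[ℓ] M]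
    (f : ↥(augIdeal ℓ G ^ m) →ₗ[ℤ_[ℓ]] M) (h : ∀ x, x.1 ∈ augIdeal ℓ G ^ n → f x = 0) :
    AugQuot ℓ G m n →ₗ[ℤ_[ℓ]] M :=
  Submodule.liftQ _ f h

variable {ℓ G} in
theorem AugQuot.lift_mk {m n : ℕ} {M : Type*} [AddCommGroup M] [Module ℤ_[ℓ] M]
    (f : ↥(augIdeal ℓ G ^ m) →ₗ[ℤ_[ℓ]] M) (h : ∀ x, x.1 ∈ augIdeal ℓ G ^ n → f x = 0)
    (x : ↥(augIdeal ℓ G ^ m)) : AugQuot.lift f h (AugQuot.mk ℓ G m n x) = f x := rfl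

/-- The action of `Aut(G)` on `I^m`. -/
noncomputable def augPowRep (m : ℕ) :
    Representation ℤ_[ℓ] (ContAut G) ↥(augIdeal ℓ G ^ m) where
  toFun σ := (CompletedGroupRing.map σ).toLinearMap.restrict (augIdeal_pow_map_le σ m)
  map_one' := LinearMap.ext fun x => Subtype.ext (CompletedGroupRing.map_one_apply x.1)
  map_mul' σ τ := LinearMap.ext fun x => Subtype.ext (CompletedGroupRing.map_mul_apply σ τ x.1)

/-- The action of `Aut(G)` on `I^m / I^n`. -/
noncomputable def augRep (m n : ℕ) : Representation ℤ_[ℓ] (ContAut G) (AugQuot ℓ G m n) where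
  toFun σ := AugQuot.lift (AugQuot.mk ℓ G m n ∘ₗ augPowRep ℓ G m σ) fun _ hx =>
    AugQuot.mk_eq_zero.2 (augIdeal_pow_map_le σ n hx)
  map_one' := LinearMap.ext fun x => by
    obtain ⟨x, rfl⟩ := AugQuot.mk_surjective x
    exact congrArg (AugQuot.mk ℓ G m n) (LinearMap.congr_fun (map_one (augPowRep ℓ G m)) x)
  map_mul' σ τ := LinearMap.ext fun x => by
    obtain ⟨x, rfl⟩ := AugQuot.mk_surjective x
    exact congrArg (AugQuot.mk ℓ G m n) (LinearMap.congr_fun (map_mul (augPowRep ℓ G m) σ τ) x)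

variable {ℓ G} in
theorem augRep_mk {m n : ℕ} (σ : ContAut G) (x : ↥(augIdeal ℓ G ^ m)) :
    augRep ℓ G m n σ (AugQuot.mk ℓ G m n x) = AugQuot.mk ℓ G m n (augPowRep ℓ G m σ x) := rfl

/-- `V = I/I²`. -/
abbrev V : Type u := AugQuot ℓ G 1 2

/-- `U = I²/I³`. -/
abbrev U : Type u := AugQuot ℓ G 2 3

/-- `E = I/I³`. -/
abbrev E : Type u := AugQuot ℓ G 1 3

/-- The inclusion `I²/I³ → I/I³`. -/
noncomputable def inclUE : U ℓ G →ₗ[ℤ_[ℓ]] E ℓ G :=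
  AugQuot.lift (AugQuot.mk ℓ G 1 3 ∘ₗ Submodule.inclusion (augIdeal_pow_succ_le 0))
    fun _ hx => AugQuot.mk_eq_zero.2 hx

/-- The projection `I/I³ → I/I²`. -/
noncomputable def projEV : E ℓ G →ₗ[ℤ_[ℓ]] V ℓ G :=
  AugQuot.lift (AugQuot.mk ℓ G 1 2) fun _ hx => AugQuot.mk_eq_zero.2 (augIdeal_pow_succ_le 1 hx)

variable {ℓ G} in
theorem mul_mem_pow {m n : ℕ} {x y : CompletedGroupRing ℓ G} (hx : x ∈ augIdeal ℓ G ^ m)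
    (hy : y ∈ augIdeal ℓ G ^ n) : x * y ∈ augIdeal ℓ G ^ (m + n) := by
  rw [pow_add]
  exact Submodule.mul_mem_mul hx hy

/-- The product `I × I → I²/I³`. -/
noncomputable def mulAux :
    ↥(augIdeal ℓ G ^ 1) →ₗ[ℤ_[ℓ]] ↥(augIdeal ℓ G ^ 1) →ₗ[ℤ_[ℓ]] U ℓ G :=
  LinearMap.mk₂ ℤ_[ℓ]
    (fun x y => AugQuot.mk ℓ G 2 3 ⟨x.1 * y.1, mul_mem_pow x.2 y.2⟩)
    (fun x x' y => by
      rw [← map_add]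
      exact congrArg _ (Subtype.ext (add_mul x.1 x'.1 y.1)))
    (fun c x y => by
      rw [← map_smul]
      exact congrArg _ (Subtype.ext (smul_mul_assoc c x.1 y.1)))
    (fun x y y' => by
      rw [← map_add]
      exact congrArg _ (Subtype.ext (mul_add x.1 y.1 y'.1)))
    (fun c x y => by
      rw [← map_smul]
      exact congrArg _ (Subtype.ext (mul_smul_comm c x.1 y.1)))

/-- The product `V × V → U`, `(x, y) ↦ xy`. -/
noncomputable def mulV : V ℓ G →ₗ[ℤ_[ℓ]] V ℓ G →ₗ[ℤ_[ℓ]] U ℓ G :=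
  AugQuot.lift
    (LinearMap.flip (AugQuot.lift (LinearMap.flip (mulAux ℓ G)) fun y hy =>
      LinearMap.ext fun x => AugQuot.mk_eq_zero.2 (mul_mem_pow (m := 1) (n := 2) x.2 hy)))
    fun x hx => LinearMap.ext fun y => by
      obtain ⟨y, rfl⟩ := AugQuot.mk_surjective y
      exact AugQuot.mk_eq_zero.2 (mul_mem_pow (m := 2) (n := 1) hx y.2)

variable {ℓ G} in
theorem mulV_mk (x y : ↥(augIdeal ℓ G ^ 1)) :
    mulV ℓ G (AugQuot.mk ℓ G 1 2 x) (AugQuot.mk ℓ G 1 2 y) =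
      AugQuot.mk ℓ G 2 3 ⟨x.1 * y.1, mul_mem_pow x.2 y.2⟩ := rfl

/-- The multiplication map `V ⊗ V → U`. -/
noncomputable def mulTensor : V ℓ G ⊗[ℤ_[ℓ]] V ℓ G →ₗ[ℤ_[ℓ]] U ℓ G :=
  TensorProduct.lift (mulV ℓ G)

/-- The alternating tensors: the `t ∈ V ⊗ V` with `ι t = -t`, where `ι (x ⊗ y) = y ⊗ x`. -/
noncomputable def altTensors : Submodule ℤ_[ℓ] (V ℓ G ⊗[ℤ_[ℓ]] V ℓ G) :=
  LinearMap.eqLocus (TensorProduct.comm ℤ_[ℓ] (V ℓ G) (V ℓ G)).toLinearMap (-LinearMap.id)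

/-- `W ⊆ I²/I³`, the image of the alternating tensors under multiplication. -/
noncomputable def W : Submodule ℤ_[ℓ] (U ℓ G) := (altTensors ℓ G).map (mulTensor ℓ G)

/-- The commutator map `m : V → Hom(V, U)`, `x ↦ (y ↦ xy - yx)`. -/
noncomputable def commutatorMap : V ℓ G →ₗ[ℤ_[ℓ]] V ℓ G →ₗ[ℤ_[ℓ]] U ℓ G :=
  mulV ℓ G - (mulV ℓ G).flip

theorem commutatorMap_apply (x y : V ℓ G) :
    commutatorMap ℓ G x y = mulV ℓ G x y - mulV ℓ G y x := rfl

theorem commutatorMap_mem (x y : V ℓ G) : commutatorMap ℓ G x y ∈ W ℓ G := by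
  refine ⟨x ⊗ₜ y - y ⊗ₜ x, ?_, ?_⟩
  · change TensorProduct.comm _ _ _ (x ⊗ₜ y - y ⊗ₜ x) = -(x ⊗ₜ y - y ⊗ₜ x)
    simp
  · simp [mulTensor, commutatorMap_apply]

/-- The commutator map, with values in `Hom(V, W)`. -/
noncomputable def commutatorMapW : V ℓ G →ₗ[ℤ_[ℓ]] V ℓ G →ₗ[ℤ_[ℓ]] ↥(W ℓ G) :=
  LinearMap.mk₂ ℤ_[ℓ] (fun x y => ⟨commutatorMap ℓ G x y, commutatorMap_mem ℓ G x y⟩)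
    (fun x x' y => Subtype.ext (by simp))
    (fun c x y => Subtype.ext (by simp))
    (fun x y y' => Subtype.ext (by simp))
    (fun c x y => Subtype.ext (by simp))

variable {ℓ G}

theorem augRep_mulV (σ : ContAut G) (x y : V ℓ G) :
    augRep ℓ G 2 3 σ (mulV ℓ G x y) =
      mulV ℓ G (augRep ℓ G 1 2 σ x) (augRep ℓ G 1 2 σ y) := by
  obtain ⟨x, rfl⟩ := AugQuot.mk_surjective x
  obtain ⟨y, rfl⟩ := AugQuot.mk_surjective y
  exact congrArg (AugQuot.mk ℓ G 2 3) (Subtype.ext (map_mul (CompletedGroupRing.map σ) x.1 y.1))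

theorem augRep_W_le (σ : ContAut G) : W ℓ G ≤ (W ℓ G).comap (augRep ℓ G 2 3 σ) := by
  rintro _ ⟨t, ht, rfl⟩
  refine ⟨TensorProduct.map (augRep ℓ G 1 2 σ) (augRep ℓ G 1 2 σ) t, ?_, ?_⟩
  · have ht' : TensorProduct.comm _ _ _ t = -t := ht
    change TensorProduct.comm _ _ _ (TensorProduct.map _ _ t) = -(TensorProduct.map _ _ t)
    rw [← map_neg, ← ht']
    exact (TensorProduct.map_comm _ _ t).symm
  · clear ht
    induction t using TensorProduct.induction_on with
    | zero => simp
    | tmul x y => simp [mulTensor, augRep_mulV]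
    | add a b ha hb => rw [map_add, map_add, map_add, map_add, ha, hb]

/-- Inner automorphisms act trivially on `I^n / I^(n+1)`. -/
theorem augRep_conj [IsTopologicalGroup G] (n : ℕ) (g : G) (x : AugQuot ℓ G n (n + 1)) :
    augRep ℓ G n (n + 1) (conj g) x = x := by
  obtain ⟨x, rfl⟩ := AugQuot.mk_surjective x
  rw [augRep_mk, ← sub_eq_zero, ← map_sub]
  refine AugQuot.mk_eq_zero.2 ?_
  change CompletedGroupRing.map (conj g) x.1 - x.1 ∈ augIdeal ℓ G ^ (n + 1)
  set a := of ℓ g - 1 with ha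
  set b := of ℓ g⁻¹ - 1 with hb
  have hgb : of ℓ g * of ℓ g⁻¹ = 1 := by rw [← map_mul, mul_inv_cancel, map_one]
  have key : CompletedGroupRing.map (conj g) x.1 - x.1 =
      (a * x.1 - x.1 * a) + (a * x.1 - x.1 * a) * b := by
    have h : CompletedGroupRing.map (conj g) x.1 - x.1 =
        of ℓ g * x.1 * of ℓ g⁻¹ - x.1 * (of ℓ g * of ℓ g⁻¹) := by
      rw [hgb, mul_one, map_conj]
    rw [h, ha, hb]
    noncomm_ring
  have hc : a * x.1 - x.1 * a ∈ augIdeal ℓ G ^ (n + 1) := by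
    refine Submodule.sub_mem _ ?_ ?_
    · rw [pow_succ']
      exact Submodule.mul_mem_mul (of_sub_one_mem g) x.2
    · rw [pow_succ]
      exact Submodule.mul_mem_mul x.2 (of_sub_one_mem g)
  rw [key]
  refine Submodule.add_mem _ hc (augIdeal_pow_succ_le n ?_)
  rw [pow_succ]
  exact Submodule.mul_mem_mul hc (of_sub_one_mem g⁻¹)

end Augmentation

/-! ### First continuous cohomology -/

section Cohomology

variable {k Γ Γ' M M' : Type*} [CommRing k]
  [Group Γ] [TopologicalSpace Γ] [Group Γ'] [TopologicalSpace Γ']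
  [AddCommGroup M] [Module k M] [TopologicalSpace M] [IsTopologicalAddGroup M]
  [AddCommGroup M'] [Module k M'] [TopologicalSpace M'] [IsTopologicalAddGroup M']

/-- Continuous 1-cocycles (crossed homomorphisms) `c : Γ → M`, `c (gh) = c g + g (c h)`. -/
def Z1 (ρ : Representation k Γ M) : AddSubgroup (Γ → M) where
  carrier := {c | Continuous c ∧ ∀ g h, c (g * h) = c g + ρ g (c h)}
  zero_mem' := ⟨continuous_const, fun g h => by simp⟩
  add_mem' := by
    rintro a b ⟨ha, ha'⟩ ⟨hb, hb'⟩
    refine ⟨ha.add hb, fun g h => ?_⟩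
    simp only [Pi.add_apply, ha', hb', map_add]
    abel
  neg_mem' := by
    rintro a ⟨ha, ha'⟩
    refine ⟨ha.neg, fun g h => ?_⟩
    simp only [Pi.neg_apply, ha', map_neg]
    abel

/-- The 1-coboundaries `g ↦ g m - m`. -/
def B1 (ρ : Representation k Γ M) : AddSubgroup (Z1 ρ) where
  carrier := {z | ∃ m : M, ∀ g, z.1 g = ρ g m - m}
  zero_mem' := ⟨0, fun g => by simp⟩
  add_mem' := by
    rintro a b ⟨m, hm⟩ ⟨n, hn⟩
    refine ⟨m + n, fun g => ?_⟩
    change a.1 g + b.1 g = _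
    rw [hm, hn, map_add]
    abel
  neg_mem' := by
    rintro a ⟨m, hm⟩
    refine ⟨-m, fun g => ?_⟩
    change -a.1 g = _
    rw [hm, map_neg]
    abel

/-- The first continuous cohomology group `H¹(Γ, M)`: continuous 1-cocycles modulo
1-coboundaries. -/
abbrev H1 (ρ : Representation k Γ M) : Type _ := Z1 ρ ⧸ B1 ρ

/-- The class of a cocycle. -/
def H1.mk {ρ : Representation k Γ M} : Z1 ρ →+ H1 ρ := QuotientAddGroup.mk' (B1 ρ)

/-- Functoriality: a continuous homomorphism `φ : Γ' → Γ` and a continuous `φ`-equivariant map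
`f : M → M'` induce `H¹(Γ, M) → H¹(Γ', M')`, `[c] ↦ [f ∘ c ∘ φ]`. -/
def H1.map (ρ : Representation k Γ M) (ρ' : Representation k Γ' M')
    (φ : Γ' →* Γ) (hφ : Continuous φ) (f : M →ₗ[k] M') (hf : Continuous f)
    (hequiv : ∀ g x, f (ρ (φ g) x) = ρ' g (f x)) : H1 ρ →+ H1 ρ' :=
  QuotientAddGroup.map (B1 ρ) (B1 ρ')
    { toFun := fun z => ⟨fun g => f (z.1 (φ g)), hf.comp (z.2.1.comp hφ), fun g h => by
        change f (z.1 (φ (g * h))) = f (z.1 (φ g)) + ρ' g (f (z.1 (φ h)))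
        rw [map_mul, z.2.2, map_add, hequiv]⟩
      map_zero' := Subtype.ext (funext fun _ => map_zero f)
      map_add' := fun _ _ => Subtype.ext (funext fun _ => map_add f _ _) }
    (by
      rintro z ⟨m, hm⟩
      refine ⟨f m, fun g => ?_⟩
      change f (z.1 (φ g)) = _
      rw [hm, map_sub, hequiv])

end Cohomology

section PointwiseTopology

variable {k M M' : Type*} [CommRing k] [AddCommGroup M] [Module k M] [AddCommGroup M'] [Module k M']
  [TopologicalSpace M']

/-- The topology of pointwise convergence on a module of linear maps. For finitely generated
modules over `ℤ_ℓ` with their profinite topology, it is the profinite topology on `Hom`. -/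
instance : TopologicalSpace (M →ₗ[k] M') :=
  TopologicalSpace.induced (fun f x => f x) inferInstance

instance [IsTopologicalAddGroup M'] : IsTopologicalAddGroup (M →ₗ[k] M') :=
  topologicalAddGroup_induced
    ({ toFun := fun f x => f x, map_zero' := rfl, map_add' := fun _ _ => rfl } :
      (M →ₗ[k] M') →+ (M → M'))

theorem continuous_linearMap_apply (x : M) : Continuous fun f : M →ₗ[k] M' => f x :=
  (continuous_apply x).comp continuous_induced_dom

end PointwiseTopology

/-! ### The coefficient modules -/

section Coefficients

variable (ℓ : ℕ) [Fact ℓ.Prime]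
variable (G : Type u) [Group G] [TopologicalSpace G]

/-- `Hom(V, U) = Hom(I/I², I²/I³)`. -/
abbrev HomVU : Type u := V ℓ G →ₗ[ℤ_[ℓ]] U ℓ G

/-- `Hom(V, W)`. -/
abbrev HomVW : Type u := V ℓ G →ₗ[ℤ_[ℓ]] ↥(W ℓ G)

/-- `A(G)`, the cokernel of the commutator map `V → Hom(V, U)`. -/
abbrev A : Type u := HomVU ℓ G ⧸ LinearMap.range (commutatorMap ℓ G)

/-- `A_W(G)`, the cokernel of the commutator map `V → Hom(V, W)`. -/
abbrev AW : Type u := HomVW ℓ G ⧸ LinearMap.range (commutatorMapW ℓ G)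

/-- The action of `Aut(G)` on `Hom(V, U)`, `(σ f)(v) = σ (f (σ⁻¹ v))`. -/
noncomputable def repHomVU : Representation ℤ_[ℓ] (ContAut G) (HomVU ℓ G) :=
  (augRep ℓ G 1 2).linHom (augRep ℓ G 2 3)

/-- The action of `Aut(G)` on `W`. -/
noncomputable def repW : Representation ℤ_[ℓ] (ContAut G) ↥(W ℓ G) :=
  (augRep ℓ G 2 3).subrepresentation (W ℓ G) augRep_W_le

/-- The action of `Aut(G)` on `Hom(V, W)`. -/
noncomputable def repHomVW : Representation ℤ_[ℓ] (ContAut G) (HomVW ℓ G) :=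
  (augRep ℓ G 1 2).linHom (repW ℓ G)

/-- The inclusion `Hom(V, W) → Hom(V, U)`. -/
noncomputable def inclHom : HomVW ℓ G →ₗ[ℤ_[ℓ]] HomVU ℓ G where
  toFun f := (W ℓ G).subtype ∘ₗ f
  map_add' _ _ := rfl
  map_smul' _ _ := rfl

variable {ℓ G}

theorem repHomVU_apply (σ : ContAut G) (f : HomVU ℓ G) (v : V ℓ G) :
    repHomVU ℓ G σ f v = augRep ℓ G 2 3 σ (f (augRep ℓ G 1 2 σ⁻¹ v)) := rfl

theorem repHomVW_apply (σ : ContAut G) (f : HomVW ℓ G) (v : V ℓ G) :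
    (repHomVW ℓ G σ f v : U ℓ G) = augRep ℓ G 2 3 σ (f (augRep ℓ G 1 2 σ⁻¹ v)) := rfl

theorem inclHom_rep (σ : ContAut G) (f : HomVW ℓ G) :
    inclHom ℓ G (repHomVW ℓ G σ f) = repHomVU ℓ G σ (inclHom ℓ G f) := rfl

theorem repHomVU_commutatorMap (σ : ContAut G) (x : V ℓ G) :
    repHomVU ℓ G σ (commutatorMap ℓ G x) = commutatorMap ℓ G (augRep ℓ G 1 2 σ x) := by
  refine LinearMap.ext fun v => ?_
  have h : augRep ℓ G 1 2 σ (augRep ℓ G 1 2 σ⁻¹ v) = v := by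
    rw [← Module.End.mul_apply, ← map_mul, mul_inv_cancel, map_one, Module.End.one_apply]
  rw [repHomVU_apply, commutatorMap_apply, commutatorMap_apply, map_sub, augRep_mulV, augRep_mulV,
    h]

theorem repHomVW_commutatorMapW (σ : ContAut G) (x : V ℓ G) :
    repHomVW ℓ G σ (commutatorMapW ℓ G x) = commutatorMapW ℓ G (augRep ℓ G 1 2 σ x) :=
  LinearMap.ext fun v => Subtype.ext
    (LinearMap.congr_fun (repHomVU_commutatorMap σ x) v)

theorem inclHom_commutatorMapW (x : V ℓ G) :
    inclHom ℓ G (commutatorMapW ℓ G x) = commutatorMap ℓ G x := rfl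

variable (ℓ G)

/-- The action of `Aut(G)` on `A(G)`. -/
noncomputable def repA : Representation ℤ_[ℓ] (ContAut G) (A ℓ G) :=
  (repHomVU ℓ G).quotient _ (by
    rintro σ _ ⟨x, rfl⟩
    exact ⟨_, (repHomVU_commutatorMap σ x).symm⟩)

/-- The action of `Aut(G)` on `A_W(G)`. -/
noncomputable def repAW : Representation ℤ_[ℓ] (ContAut G) (AW ℓ G) :=
  (repHomVW ℓ G).quotient _ (by
    rintro σ _ ⟨x, rfl⟩
    exact ⟨_, (repHomVW_commutatorMapW σ x).symm⟩)

/-- The map `A_W(G) → A(G)` induced by the inclusion `Hom(V, W) → Hom(V, U)`. -/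
noncomputable def inclA : AW ℓ G →ₗ[ℤ_[ℓ]] A ℓ G :=
  Submodule.mapQ _ _ (inclHom ℓ G) (by
    rintro _ ⟨x, rfl⟩
    exact ⟨x, rfl⟩)

variable {ℓ G}

theorem inclA_rep (σ : ContAut G) (x : AW ℓ G) :
    inclA ℓ G (repAW ℓ G σ x) = repA ℓ G σ (inclA ℓ G x) := by
  induction x using Submodule.Quotient.induction_on with
  | H f => rfl

theorem continuous_inclHom : Continuous (inclHom ℓ G) :=
  continuous_induced_rng.2 <| continuous_pi fun v =>
    continuous_subtype_val.comp (continuous_linearMap_apply v)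

theorem continuous_inclA : Continuous (inclA ℓ G) :=
  continuous_quot_lift _ (continuous_quot_mk.comp continuous_inclHom)

variable [IsTopologicalGroup G]

/-! Inner automorphisms act trivially on all these modules, which makes them `Out(G)`-modules. -/

theorem repHomVU_inner (s : Inn G) (f : HomVU ℓ G) : repHomVU ℓ G s.1 f = f := by
  obtain ⟨_, ⟨g, rfl⟩⟩ := s
  refine LinearMap.ext fun v => ?_
  change augRep ℓ G 2 3 (conj g) (f (augRep ℓ G 1 2 (conj g)⁻¹ v)) = f v
  rw [← map_inv, augRep_conj 1, augRep_conj 2]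

theorem repHomVW_inner (s : Inn G) (f : HomVW ℓ G) : repHomVW ℓ G s.1 f = f :=
  LinearMap.ext fun v => Subtype.ext
    (LinearMap.congr_fun (repHomVU_inner s (inclHom ℓ G f)) v)

instance : Representation.IsTrivial ((repHomVU ℓ G).comp (Inn G).subtype) :=
  ⟨fun s => LinearMap.ext (repHomVU_inner s)⟩

instance : Representation.IsTrivial ((repA ℓ G).comp (Inn G).subtype) :=
  ⟨fun s => LinearMap.ext fun x => by
    induction x using Submodule.Quotient.induction_on with
    | H f => exact congrArg Submodule.Quotient.mk (repHomVU_inner s f)⟩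

instance : Representation.IsTrivial ((repAW ℓ G).comp (Inn G).subtype) :=
  ⟨fun s => LinearMap.ext fun x => by
    induction x using Submodule.Quotient.induction_on with
    | H f => exact congrArg Submodule.Quotient.mk (repHomVW_inner s f)⟩

variable (ℓ G)

/-- The action of `Out(G)` on `Hom(V, U)`. -/
noncomputable def repHomVUOut : Representation ℤ_[ℓ] (ContOut G) (HomVU ℓ G) :=
  (repHomVU ℓ G).ofQuotient (Inn G)

/-- The action of `Out(G)` on `A(G)`. -/
noncomputable def repAOut : Representation ℤ_[ℓ] (ContOut G) (A ℓ G) :=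
  (repA ℓ G).ofQuotient (Inn G)

/-- The action of `Out(G)` on `A_W(G)`. -/
noncomputable def repAWOut : Representation ℤ_[ℓ] (ContOut G) (AW ℓ G) :=
  (repAW ℓ G).ofQuotient (Inn G)

end Coefficients

/-! ### The modified diagonal class and the Johnson class -/

section Classes

variable (ℓ : ℕ) [Fact ℓ.Prime]
variable (G : Type u) [Group G] [TopologicalSpace G]

/-- `H¹(Aut(G), Hom(V, W)) → H¹(Aut(G), Hom(V, U))`. -/
noncomputable def coeffMapAut : H1 (repHomVW ℓ G) →+ H1 (repHomVU ℓ G) :=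
  H1.map _ _ (MonoidHom.id _) continuous_id (inclHom ℓ G) continuous_inclHom inclHom_rep

/-- `H¹(Aut(G), Hom(V, U)) → H¹(Aut(G), A(G))`. -/
noncomputable def toAAut : H1 (repHomVU ℓ G) →+ H1 (repA ℓ G) :=
  H1.map _ _ (MonoidHom.id _) continuous_id
    (LinearMap.range (commutatorMap ℓ G)).mkQ continuous_quot_mk fun _ _ => rfl

/-- `c` is the class in `H¹(Aut(G), Hom(V, U))` of the extension
`0 → I²/I³ → I/I³ → I/I² → 0`: for some `ℤ_ℓ`-linear section `s` of `I/I³ → I/I²`, it is the class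
of the cocycle `σ ↦ σ ∘ s ∘ σ⁻¹ - s`, which takes values in `Hom(I/I², I²/I³)`. -/
def IsModifiedDiagonalClass (c : H1 (repHomVU ℓ G)) : Prop :=
  ∃ (s : V ℓ G →ₗ[ℤ_[ℓ]] E ℓ G) (z : Z1 (repHomVU ℓ G)),
    (∀ v, projEV ℓ G (s v) = v) ∧
    (∀ σ v, inclUE ℓ G (z.1 σ v) = augRep ℓ G 1 3 σ (s (augRep ℓ G 1 2 σ⁻¹ v)) - s v) ∧
    H1.mk z = c

variable [IsTopologicalGroup G]

/-- `H¹(Out(G), A_W(G)) → H¹(Out(G), A(G))`. -/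
noncomputable def coeffMapOut : H1 (repAWOut ℓ G) →+ H1 (repAOut ℓ G) :=
  H1.map _ _ (MonoidHom.id _) continuous_id (inclA ℓ G) continuous_inclA fun g x => by
    induction g using QuotientGroup.induction_on with
    | H σ => exact inclA_rep σ x

/-- The inflation map `H¹(Out(G), A(G)) → H¹(Aut(G), A(G))`. -/
noncomputable def inflation : H1 (repAOut ℓ G) →+ H1 (repA ℓ G) :=
  H1.map _ _ (QuotientGroup.mk' (Inn G)) continuous_quot_mk LinearMap.id continuous_id
    fun _ _ => rfl

/-- `j` is a Johnson class: its inflation in `H¹(Aut(G), A(G))` is the image of the modified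
diagonal class. -/
def IsJohnsonClass (j : H1 (repAOut ℓ G)) : Prop :=
  ∃ c, IsModifiedDiagonalClass ℓ G c ∧ inflation ℓ G j = toAAut ℓ G c

end Classes

/-- The vanishing `H⁰(Γ, M ⊗ ℤ_ℓ/2) = 0`, with `Γ` acting through `M`. -/
def H0ModTwoVanishes (ℓ : ℕ) [Fact ℓ.Prime] {Γ M : Type*} [Group Γ] [AddCommGroup M]
    [Module ℤ_[ℓ] M] (ρ : Representation ℤ_[ℓ] Γ M) : Prop :=
  (ρ.tprod (Representation.trivial ℤ_[ℓ] Γ (ℤ_[ℓ] ⧸ Ideal.span {(2 : ℤ_[ℓ])}))).invariants = ⊥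

end ProEll

/-!
An automorphism `σ` inverting `G^ab` acts as `-1` on `V`, hence as `+1` on `U`, the image of
`V ⊗ V`, and as `-1` on `Hom(V, U)`. For a cocycle `z` representing the class of the extension,
comparing two expansions of `z(τσ)` gives `2 z(τ) + (τ z(σ) - z(σ)) = z(τστ⁻¹) - z(σ)`. Both `σ` and
`τστ⁻¹` invert `G^ab`, and modulo the preimage of `W` in `I²` the element `[g] ∈ ℤ_ℓ[[G]]` depends
only on the image of `g` in `G^ab`, so the right-hand side has values in `Hom(V, W)`. Thus twice
the class comes from `Hom(V, W)`, and the same computation descends to `Out(G)`.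

For uniqueness, `-1` acts on the coefficients, so the map on `H¹` is injective as soon as `U / W`
has no 2-torsion. This holds because the kernel of `V ⊗ V → U` consists of alternating tensors: a
homomorphism `F` from a finite quotient of `G` to an additive group gives a functional `F ⊗ F` on
`I² / I³`, and such functionals detect the symmetrization of a tensor.
-/

namespace ProEll

open CompletedGroupRing Topology commutatorElement

/-! ### Injectivity and descent for first cohomology -/

section Cohomology

variable {k Γ Γ' M M' : Type*} [CommRing k]
  [Group Γ] [TopologicalSpace Γ] [Group Γ'] [TopologicalSpace Γ']
  [AddCommGroup M] [Module k M] [TopologicalSpace M] [IsTopologicalAddGroup M]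
  [AddCommGroup M'] [Module k M'] [TopologicalSpace M'] [IsTopologicalAddGroup M']
  {ρ : Representation k Γ M} {ρ' : Representation k Γ' M'}

theorem H1.mk_surjective : Function.Surjective (H1.mk (ρ := ρ)) := QuotientAddGroup.mk'_surjective _

theorem H1.mk_eq_zero {z : Z1 ρ} : H1.mk z = 0 ↔ ∃ m, ∀ g, z.1 g = ρ g m - m :=
  QuotientAddGroup.eq_zero_iff z

theorem H1.mk_eq_mk {z z' : Z1 ρ} :
    H1.mk z = H1.mk z' ↔ ∃ m, ∀ g, z.1 g - z'.1 g = ρ g m - m := by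
  rw [← sub_eq_zero, ← map_sub, H1.mk_eq_zero]
  rfl

theorem H1.map_injective {φ : Γ' →* Γ} {hφ : Continuous φ} {f : M →ₗ[k] M'} {hf : Continuous f}
    {hequiv : ∀ g x, f (ρ (φ g) x) = ρ' g (f x)} (hφs : Function.Surjective φ)
    (hfi : Function.Injective f)
    (h : ∃ σ, ∀ m, ρ' σ m - m ∈ LinearMap.range f → m ∈ LinearMap.range f) :
    Function.Injective (H1.map ρ ρ' φ hφ f hf hequiv) := by
  refine (injective_iff_map_eq_zero _).2 fun x hx => ?_
  obtain ⟨z, rfl⟩ := H1.mk_surjective x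
  obtain ⟨m', hm'⟩ := H1.mk_eq_zero.1 hx
  obtain ⟨σ, hσ⟩ := h
  obtain ⟨m, rfl⟩ := hσ m' (hm' σ ▸ LinearMap.mem_range_self f _)
  refine H1.mk_eq_zero.2 ⟨m, fun g => hfi ?_⟩
  obtain ⟨g', rfl⟩ := hφs g
  rw [map_sub, hequiv]
  exact hm' g'

theorem H1.map_injective_of_neg {ρ' : Representation k Γ M'} {f : M →ₗ[k] M'} {hf : Continuous f}
    {hequiv : ∀ g x, f (ρ g x) = ρ' g (f x)} (hfi : Function.Injective f) {σ : Γ}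
    (hσ : ∀ m, ρ' σ m = -m)
    (h2 : ∀ m, (2 : k) • m ∈ LinearMap.range f → m ∈ LinearMap.range f) :
    Function.Injective (H1.map ρ ρ' (MonoidHom.id Γ) continuous_id f hf hequiv) :=
  H1.map_injective Function.surjective_id hfi ⟨σ, fun m hm => h2 m <| by
    rwa [hσ, ← neg_add', neg_mem_iff, ← two_smul k] at hm⟩

theorem Z1.exists_lift {ρ' : Representation k Γ M'} {f : M →ₗ[k] M'} (hf : IsInducing f)
    (hfi : Function.Injective f) (hequiv : ∀ g x, f (ρ g x) = ρ' g (f x)) (z : Z1 ρ')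
    (hz : ∀ g, z.1 g ∈ LinearMap.range f) : ∃ y : Z1 ρ, ∀ g, f (y.1 g) = z.1 g := by
  choose y hy using hz
  refine ⟨⟨y, hf.continuous_iff.2 (z.2.1.congr fun g => (hy g).symm), fun g h => hfi ?_⟩, hy⟩
  rw [map_add, hequiv, hy, hy, hy, z.2.2]

/-- The coboundary `g ↦ g m - m` of an element `m` with continuous orbit map. -/
def Z1.coboundary (ρ : Representation k Γ M) (m : M) (hm : Continuous fun g => ρ g m) : Z1 ρ :=
  ⟨fun g => ρ g m - m, hm.sub continuous_const, fun g h => by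
    change ρ (g * h) m - m = ρ g m - m + ρ g (ρ h m - m)
    rw [map_mul, Module.End.mul_apply, map_sub]
    abel⟩

theorem H1.mk_coboundary {m : M} {hm : Continuous fun g => ρ g m} :
    H1.mk (Z1.coboundary ρ m hm) = 0 :=
  H1.mk_eq_zero.2 ⟨m, fun _ => rfl⟩

/-- Compare the two expansions of `z (τ * σ) = z (τ * σ * τ⁻¹ * τ)`. -/
theorem Z1.two_nsmul_add_coboundary_of_neg (z : Z1 ρ) {σ : Γ} (hσ : ∀ m, ρ σ m = -m) (τ : Γ) :
    2 • z.1 τ + (ρ τ (z.1 σ) - z.1 σ) = z.1 (τ * σ * τ⁻¹) - z.1 σ := by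
  have hconj (m : M) : ρ (τ * σ * τ⁻¹) m = -m := by
    rw [map_mul, map_mul, Module.End.mul_apply, Module.End.mul_apply, hσ, map_neg,
      Representation.self_inv_apply]
  have h := z.2.2 (τ * σ * τ⁻¹) τ
  rw [inv_mul_cancel_right, z.2.2 τ σ, hconj, ← sub_eq_add_neg, eq_sub_iff_add_eq] at h
  rw [← h]
  abel

theorem H1.exists_inflation_eq_map {ρ' : Representation k Γ M'} (S : Subgroup Γ) [S.Normal]
    [Representation.IsTrivial (ρ'.comp S.subtype)] {f : M →ₗ[k] M'} (hf : Continuous f)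
    (hequiv : ∀ g x, f (ρ g x) = ρ' g (f x)) (z : Z1 ρ) (hz : ∀ s ∈ S, f (z.1 s) = 0) :
    ∃ y : H1 (ρ'.ofQuotient S), H1.map (ρ'.ofQuotient S) ρ' (QuotientGroup.mk' S)
      continuous_quot_mk LinearMap.id continuous_id (fun _ _ => rfl) y =
        H1.map ρ ρ' (MonoidHom.id Γ) continuous_id f hf hequiv (H1.mk z) := by
  have hcocycle (g h : Γ) : f (z.1 (g * h)) = f (z.1 g) + ρ' g (f (z.1 h)) := by
    rw [z.2.2, map_add, hequiv]
  have hconst (g h : Γ) (H : QuotientGroup.leftRel S g h) : f (z.1 g) = f (z.1 h) := by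
    have hgh := hcocycle g (g⁻¹ * h)
    rw [mul_inv_cancel_left, hz _ (QuotientGroup.leftRel_apply.1 H), map_zero, add_zero] at hgh
    exact hgh.symm
  refine ⟨H1.mk ⟨Quotient.lift (fun g => f (z.1 g)) hconst,
    continuous_quot_lift _ (hf.comp z.2.1), fun p q => ?_⟩, rfl⟩
  induction p using QuotientGroup.induction_on with
  | H p =>
    induction q using QuotientGroup.induction_on with
    | H q => exact hcocycle p q

end Cohomology

/-! ### Finitely generated modules over a compact ring -/

section CompactModules

variable {R M F : Type*} [CommRing R] [TopologicalSpace R] [CompactSpace R]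
  [AddCommGroup M] [Module R M] [TopologicalSpace M] [IsTopologicalAddGroup M]
  [ContinuousSMul R M] [T2Space M] [Module.Finite R M]
  [AddCommGroup F] [Module R F] [TopologicalSpace F] [IsTopologicalAddGroup F]
  [ContinuousSMul R F]

theorem continuous_linearMap_of_finite (f : M →ₗ[R] F) : Continuous f := by
  obtain ⟨n, π, hπ⟩ := Module.Finite.exists_fin' R M
  have hc : Continuous π := LinearMap.continuous_on_pi π
  exact (hc.isClosedMap.isQuotientMap hc hπ).continuous_iff.2
    (LinearMap.continuous_on_pi (f ∘ₗ π))

theorem isInducing_linearMap_of_injective [T2Space F] {f : M →ₗ[R] F} (hf : Function.Injective f) :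
    IsInducing f := by
  have : CompactSpace M := Module.Finite.compactSpace R M
  exact ((continuous_linearMap_of_finite f).isClosedEmbedding hf).isInducing

end CompactModules

theorem isInducing_compRight {R P M F : Type*} [CommRing R] [AddCommGroup P] [Module R P]
    [AddCommGroup M] [Module R M] [TopologicalSpace M] [AddCommGroup F] [Module R F]
    [TopologicalSpace F] {f : M →ₗ[R] F} (hf : IsInducing f) :
    IsInducing (LinearMap.compRight R (M := P) f) := by
  have hcoe : IsInducing fun (g : P →ₗ[R] M) x => f (g x) :=
    (IsInducing.piMap fun _ : P => hf).comp ⟨rfl⟩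
  exact .of_comp (continuous_induced_rng.2 hcoe.continuous) continuous_induced_dom hcoe

/-! ### The topology of the completed group ring -/

section Topology

variable {ℓ : ℕ} [Fact ℓ.Prime] {G : Type u} [Group G] [TopologicalSpace G]

instance finite_quotient [IsTopologicalGroup G] [CompactSpace G] (N : OpenNormalSubgroup G) :
    Finite (G ⧸ N.toSubgroup) :=
  Subgroup.quotient_finite_of_isOpen _ N.isOpen'

theorem CompletedGroupRing.isInducing_coeffHom :
    IsInducing (coeffHom (ℓ := ℓ) (G := G)) := ⟨rfl⟩

theorem CompletedGroupRing.coeffHom_injective :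
    Function.Injective (coeffHom (ℓ := ℓ) (G := G)) := fun _ _ h =>
  CompletedGroupRing.ext fun N => MonoidAlgebra.coeff_injective (DFunLike.coe_injective
    (congrFun h N))

instance : T2Space (CompletedGroupRing ℓ G) :=
  T2Space.of_injective_continuous coeffHom_injective isInducing_coeffHom.continuous

theorem CompletedGroupRing.continuous_coeff_proj (N : OpenNormalSubgroup G)
    (q : G ⧸ N.toSubgroup) :
    Continuous fun x : CompletedGroupRing ℓ G => (proj ℓ N x).coeff q :=
  continuous_pi_iff.1 (continuous_pi_iff.1 isInducing_coeffHom.continuous N) q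

theorem CompletedGroupRing.continuous_rng {X : Type*} [TopologicalSpace X]
    {f : X → CompletedGroupRing ℓ G}
    (h : ∀ (N : OpenNormalSubgroup G) (q : G ⧸ N.toSubgroup),
      Continuous fun x => (proj ℓ N (f x)).coeff q) : Continuous f :=
  isInducing_coeffHom.continuous_iff.2 (continuous_pi fun N => continuous_pi (h N))

instance : ContinuousSMul ℤ_[ℓ] (CompletedGroupRing ℓ G) where
  continuous_smul := continuous_rng fun N q => by
    simp only [map_smul, MonoidAlgebra.coeff_smul_apply]
    exact continuous_fst.smul ((continuous_coeff_proj N q).comp continuous_snd)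

theorem CompletedGroupRing.continuous_of [IsTopologicalGroup G] :
    Continuous (of ℓ : G → CompletedGroupRing ℓ G) :=
  continuous_rng fun N q => by
    have : DiscreteTopology (G ⧸ N.toSubgroup) := QuotientGroup.discreteTopology N.isOpen'
    exact (continuous_of_discreteTopology (f := fun p : G ⧸ N.toSubgroup =>
      (MonoidAlgebra.single p (1 : ℤ_[ℓ])).coeff q)).comp continuous_quot_mk

variable [IsTopologicalGroup G] [CompactSpace G]

instance : IsTopologicalRing (CompletedGroupRing ℓ G) where
  continuous_mul := continuous_rng fun N q => by
    classical
    have := Fintype.ofFinite (G ⧸ N.toSubgroup)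
    simp only [map_mul, MonoidAlgebra.coeff_mul_antidiag _ _ q
      (Finset.univ.filter fun p => p.1 * p.2 = q) (by simp)]
    exact continuous_finsetSum _ fun p _ => ((continuous_coeff_proj N p.1).comp continuous_fst).mul
      ((continuous_coeff_proj N p.2).comp continuous_snd)

/-- The identification of `R[M]` with the functions on a finite type `M`, through which `R[M]`
receives the product topology. -/
noncomputable def coeffLinearEquiv (R M : Type*) [CommSemiring R] [Finite M] :
    MonoidAlgebra R M ≃ₗ[R] (M → R) :=
  (MonoidAlgebra.coeffLinearEquiv R).trans (Finsupp.linearEquivFunOnFinite R R M)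

theorem CompletedGroupRing.continuous_linear_proj {F : Type*} [AddCommGroup F] [Module ℤ_[ℓ] F]
    [TopologicalSpace F] [ContinuousAdd F] [ContinuousSMul ℤ_[ℓ] F]
    (N : OpenNormalSubgroup G) (f : MonoidAlgebra ℤ_[ℓ] (G ⧸ N.toSubgroup) →ₗ[ℤ_[ℓ]] F) :
    Continuous fun x : CompletedGroupRing ℓ G => f (proj ℓ N x) := by
  have hf := LinearMap.continuous_on_pi
    (f ∘ₗ (coeffLinearEquiv ℤ_[ℓ] (G ⧸ N.toSubgroup)).symm.toLinearMap)
  exact (hf.comp (continuous_pi (continuous_coeff_proj N))).congr fun x =>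
    congrArg f (LinearEquiv.symm_apply_apply (coeffLinearEquiv _ _) _)

theorem CompletedGroupRing.range_coeffHom : Set.range (coeffHom (ℓ := ℓ) (G := G)) =
    ⋂ (N : OpenNormalSubgroup G) (M : OpenNormalSubgroup G)
      (h : ∀ g ∈ N.toSubgroup, MonoidHom.id G g ∈ M.toSubgroup),
      {f | coeffLinearEquiv ℤ_[ℓ] _ (transition ℓ (MonoidHom.id G) h
        ((coeffLinearEquiv ℤ_[ℓ] _).symm (f N))) = f M} := by
  ext f
  simp only [Set.mem_iInter, Set.mem_ofPred_eq]
  constructor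
  · rintro ⟨x, rfl⟩ N M h
    have hx : (coeffLinearEquiv ℤ_[ℓ] (G ⧸ N.toSubgroup)).symm (coeffHom x N) = proj ℓ N x :=
      (LinearEquiv.symm_apply_eq _).2 rfl
    rw [hx, transition_proj]
    rfl
  · intro hf
    refine ⟨⟨fun N => (coeffLinearEquiv _ _).symm (f N), fun N M h =>
      (LinearEquiv.eq_symm_apply _).2 (hf N M h)⟩, ?_⟩
    exact funext fun N => LinearEquiv.apply_symm_apply (coeffLinearEquiv _ _) (f N)

theorem CompletedGroupRing.isClosed_range_coeffHom :
    IsClosed (Set.range (coeffHom (ℓ := ℓ) (G := G))) := by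
  rw [range_coeffHom]
  refine isClosed_iInter fun N => isClosed_iInter fun M => isClosed_iInter fun h =>
    isClosed_eq ?_ (continuous_apply M)
  exact (LinearMap.continuous_on_pi ((coeffLinearEquiv ℤ_[ℓ] _).toLinearMap ∘ₗ
    (transition ℓ (MonoidHom.id G) h).toLinearMap ∘ₗ
    (coeffLinearEquiv ℤ_[ℓ] (G ⧸ N.toSubgroup)).symm.toLinearMap)).comp (continuous_apply N)

instance : CompactSpace (CompletedGroupRing ℓ G) :=
  (IsClosedEmbedding.mk ⟨isInducing_coeffHom, coeffHom_injective⟩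
    isClosed_range_coeffHom).compactSpace

theorem continuous_augmentation : Continuous (augmentation ℓ G) :=
  continuous_linear_proj (wholeGroup G)
    (MonoidAlgebra.lift ℤ_[ℓ] ℤ_[ℓ] (G ⧸ (wholeGroup G).toSubgroup) 1).toLinearMap

theorem CompletedGroupRing.continuous_map (σ : ContAut G) :
    Continuous (CompletedGroupRing.map σ : CompletedGroupRing ℓ G → CompletedGroupRing ℓ G) :=
  isInducing_coeffHom.continuous_iff.2 <| continuous_pi fun N =>
    (continuous_linear_proj (pullback σ N) ((coeffLinearEquiv ℤ_[ℓ] _).toLinearMap ∘ₗ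
      (transition ℓ (σ : G →* G) (pullback_le σ N)).toLinearMap)).congr fun x =>
        congrArg (coeffLinearEquiv ℤ_[ℓ] _) (proj_map σ x N).symm

end Topology

/-! ### Continuity of the action of `Aut(G)` -/

section Action

variable {ℓ : ℕ} [Fact ℓ.Prime] {G : Type u} [Group G] [TopologicalSpace G]

theorem transition_congr {φ ψ : G →* G} {N M : OpenNormalSubgroup G}
    (hφ : ∀ g ∈ N.toSubgroup, φ g ∈ M.toSubgroup) (hψ : ∀ g ∈ N.toSubgroup, ψ g ∈ M.toSubgroup)
    (h : ∀ g, (φ g : G ⧸ M.toSubgroup) = ψ g) : transition ℓ φ hφ = transition ℓ ψ hψ :=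
  congrArg (MonoidAlgebra.mapDomainAlgHom ℤ_[ℓ] ℤ_[ℓ])
    (QuotientGroup.monoidHom_ext _ (MonoidHom.ext h))

theorem proj_map_congr {σ τ : ContAut G} {N : OpenNormalSubgroup G}
    (h : ∀ g, (σ g : G ⧸ N.toSubgroup) = τ g) (x : CompletedGroupRing ℓ G) :
    proj ℓ N (CompletedGroupRing.map σ x) = proj ℓ N (CompletedGroupRing.map τ x) := by
  have hle : ∀ g ∈ (pullback σ N).toSubgroup, (τ : G →* G) g ∈ N.toSubgroup := fun g hg =>
    (QuotientGroup.eq_one_iff _).1 ((h g).symm.trans ((QuotientGroup.eq_one_iff _).2 hg))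
  have hle' : ∀ g ∈ (pullback σ N).toSubgroup, MonoidHom.id G g ∈ (pullback τ N).toSubgroup := hle
  rw [proj_map, proj_map, ← transition_proj x hle', transition_transition ℓ _ _ _ _ hle]
  exact DFunLike.congr_fun (transition_congr _ _ h) _

variable [IsTopologicalGroup G] [CompactSpace G]

theorem eventually_congr_mod (σ : ContAut G) (N : OpenNormalSubgroup G) :
    ∀ᶠ τ in 𝓝 σ, ∀ g, (σ g : G ⧸ N.toSubgroup) = τ g := by
  let _ : UniformSpace G := IsTopologicalGroup.rightUniformSpace G
  have hcont : Continuous fun τ : ContAut G => (⟨τ, τ.continuous⟩ : C(G, G)) :=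
    continuous_induced_dom
  have hunif := ContinuousMap.tendsto_iff_tendstoUniformly.1 (hcont.tendsto σ)
  have hN : (fun p : G × G => p.2 * p.1⁻¹) ⁻¹' N ∈ uniformity G :=
    Filter.preimage_mem_comap (N.isOpen'.mem_nhds N.one_mem)
  filter_upwards [hunif _ hN] with τ hτ g
  exact QuotientGroup.eq.2 (N.isNormal'.mem_comm (hτ g))

theorem eventually_inv_congr_mod (σ : ContAut G) (N : OpenNormalSubgroup G) :
    ∀ᶠ τ in 𝓝 σ, ∀ g, (σ⁻¹ g : G ⧸ N.toSubgroup) = τ⁻¹ g := by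
  filter_upwards [eventually_congr_mod σ (pullback σ⁻¹ N)] with τ hτ g
  have h : σ⁻¹ ((σ (τ⁻¹ g))⁻¹ * τ (τ⁻¹ g)) ∈ N.toSubgroup := QuotientGroup.eq.1 (hτ (τ⁻¹ g))
  rw [ContAut.apply_inv_apply, map_mul, map_inv, ← ContAut.mul_apply σ⁻¹ σ, inv_mul_cancel,
    ContAut.one_apply] at h
  exact (QuotientGroup.eq.2 h).symm

theorem continuous_map_of_eventually_congr_mod {f : ContAut G → ContAut G}
    (hf : ∀ (σ : ContAut G) (N : OpenNormalSubgroup G),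
      ∀ᶠ τ in 𝓝 σ, ∀ g, (f σ g : G ⧸ N.toSubgroup) = f τ g) :
    Continuous fun p : ContAut G × CompletedGroupRing ℓ G =>
      CompletedGroupRing.map (f p.1) p.2 := by
  refine continuous_rng fun N q => continuous_iff_continuousAt.2 fun ⟨σ, x⟩ => ?_
  have hσ : Continuous fun p : ContAut G × CompletedGroupRing ℓ G =>
      (proj ℓ N (CompletedGroupRing.map (f σ) p.2)).coeff q :=
    (continuous_coeff_proj N q).comp ((continuous_map (f σ)).comp continuous_snd)
  refine hσ.continuousAt.congr ?_
  filter_upwards [continuousAt_fst (hf σ N)] with p hp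
  rw [proj_map_congr hp]

variable (ℓ)

theorem continuous_augRep (m n : ℕ) :
    Continuous fun p : ContAut G × AugQuot ℓ G m n => augRep ℓ G m n p.1 p.2 := by
  have hq : IsOpenQuotientMap (AugQuot.mk ℓ G m n) :=
    QuotientAddGroup.isOpenQuotientMap_mk (N := ((augIdeal ℓ G ^ n).submoduleOf
      (augIdeal ℓ G ^ m)).toAddSubgroup)
  rw [((IsOpenQuotientMap.id (X := ContAut G)).prodMap hq).isQuotientMap.continuous_iff]
  exact hq.continuous.comp (Continuous.subtype_mk
    ((continuous_map_of_eventually_congr_mod (f := id) eventually_congr_mod).comp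
      (continuous_fst.prodMk (continuous_subtype_val.comp continuous_snd))) _)

theorem continuous_augRep_inv (m n : ℕ) (x : AugQuot ℓ G m n) :
    Continuous fun σ : ContAut G => augRep ℓ G m n σ⁻¹ x := by
  obtain ⟨x, rfl⟩ := AugQuot.mk_surjective x
  have hq : Continuous (AugQuot.mk ℓ G m n) := continuous_quot_mk
  exact hq.comp (Continuous.subtype_mk
    ((continuous_map_of_eventually_congr_mod eventually_inv_congr_mod).comp
      (continuous_id.prodMk continuous_const)) _)

end Action

/-! ### Powers of the augmentation ideal -/

/-- A topological group is topologically finitely generated if some finite set generates a dense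
subgroup. -/
class TopologicallyFG (G : Type*) [Group G] [TopologicalSpace G] [IsTopologicalGroup G] :
    Prop where
  out : ∃ S : Finset G, (Subgroup.closure (S : Set G)).topologicalClosure = ⊤

section AugmentationIdeal

variable {ℓ : ℕ} [Fact ℓ.Prime] {G : Type u} [Group G] [TopologicalSpace G]

theorem augmentation_eq_lift_one_proj (N : OpenNormalSubgroup G) (x : CompletedGroupRing ℓ G) :
    augmentation ℓ G x =
      MonoidAlgebra.lift ℤ_[ℓ] ℤ_[ℓ] (G ⧸ N.toSubgroup) 1 (proj ℓ N x) := by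
  have h : ∀ g ∈ N.toSubgroup, MonoidHom.id G g ∈ (wholeGroup G).toSubgroup := fun _ _ => trivial
  rw [← lift_transition _ h, transition_proj]
  rfl

theorem augIdeal_pow_mul_mem (n : ℕ) {x : CompletedGroupRing ℓ G} (hx : x ∈ augIdeal ℓ G ^ (n + 1))
    (y : CompletedGroupRing ℓ G) : x * y ∈ augIdeal ℓ G ^ (n + 1) := by
  have hideal : augIdeal ℓ G * ⊤ ≤ augIdeal ℓ G := Submodule.mul_le.2 fun a ha b _ => by
    have ha0 : augmentation ℓ G a = 0 := ha
    change augmentation ℓ G (a * b) = 0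
    rw [map_mul, ha0, zero_mul]
  have hpow : augIdeal ℓ G ^ (n + 1) * ⊤ ≤ augIdeal ℓ G ^ (n + 1) := by
    rw [pow_succ, mul_assoc]
    exact mul_le_mul_right hideal _
  exact hpow (Submodule.mul_mem_mul hx trivial)

theorem exists_mem_proj_eq_of_mem_augIdeal {J : Submodule ℤ_[ℓ] (CompletedGroupRing ℓ G)}
    (hJ : ∀ g, of ℓ g - 1 ∈ J) {x : CompletedGroupRing ℓ G} (hx : x ∈ augIdeal ℓ G)
    (N : OpenNormalSubgroup G) : ∃ y ∈ J, proj ℓ N y = proj ℓ N x := by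
  have key (z : MonoidAlgebra ℤ_[ℓ] (G ⧸ N.toSubgroup)) :
      z - MonoidAlgebra.single 1 (MonoidAlgebra.lift ℤ_[ℓ] ℤ_[ℓ] (G ⧸ N.toSubgroup) 1 z) ∈
        J.map (proj ℓ N).toLinearMap := by
    induction z using MonoidAlgebra.induction_linear with
    | zero => simp
    | add a b ha hb =>
      rw [map_add, MonoidAlgebra.single_add, add_sub_add_comm]
      exact Submodule.add_mem _ ha hb
    | single q a =>
      induction q using QuotientGroup.induction_on with
      | H g =>
        refine ⟨a • (of ℓ g - 1), J.smul_mem a (hJ g), ?_⟩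
        change proj ℓ N (a • (of ℓ g - 1)) = _
        rw [map_smul, map_sub, proj_of, map_one, smul_sub, MonoidAlgebra.smul_single,
          MonoidAlgebra.one_def, MonoidAlgebra.smul_single]
        simp
  have hx0 : MonoidAlgebra.lift ℤ_[ℓ] ℤ_[ℓ] (G ⧸ N.toSubgroup) 1 (proj ℓ N x) = 0 :=
    (augmentation_eq_lift_one_proj N x).symm.trans hx
  have hx' := key (proj ℓ N x)
  rwa [hx0, MonoidAlgebra.single_zero, sub_zero] at hx'

variable [IsTopologicalGroup G]

theorem of_sub_one_mem_of_mem_topologicalClosure {J : Submodule ℤ_[ℓ] (CompletedGroupRing ℓ G)}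
    (hc : IsClosed (J : Set (CompletedGroupRing ℓ G)))
    (hJ : ∀ (g : G), ∀ x ∈ J, of ℓ g * x ∈ J) {S : Set G} (hS : ∀ s ∈ S, of ℓ s - 1 ∈ J) {g : G}
    (hg : g ∈ (Subgroup.closure S).topologicalClosure) : of ℓ g - 1 ∈ J := by
  refine closure_minimal (t := {g : G | of ℓ g - 1 ∈ J}) (fun g hg => ?_)
    (hc.preimage (continuous_of.sub continuous_const)) hg
  induction hg using Subgroup.closure_induction with
  | mem s hs => exact hS s hs
  | one => simp
  | mul g h _ _ hg hh =>
    have e : of ℓ (g * h) - 1 = of ℓ g * (of ℓ h - 1) + (of ℓ g - 1) := by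
      rw [map_mul]; noncomm_ring
    rw [Set.mem_ofPred_eq, e]
    exact J.add_mem (hJ g _ hh) hg
  | inv g _ hg =>
    have e : of ℓ g⁻¹ - 1 = -(of ℓ g⁻¹ * (of ℓ g - 1)) := by
      rw [mul_sub, ← map_mul, inv_mul_cancel, map_one, mul_one, neg_sub]
    rw [Set.mem_ofPred_eq, e]
    exact J.neg_mem (hJ g⁻¹ _ hg)

variable [CompactSpace G]

theorem augIdeal_le_of_isClosed {J : Submodule ℤ_[ℓ] (CompletedGroupRing ℓ G)}
    (hc : IsClosed (J : Set (CompletedGroupRing ℓ G))) (hJ : ∀ g, of ℓ g - 1 ∈ J) :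
    augIdeal ℓ G ≤ J := by
  intro x hx
  let T (N : OpenNormalSubgroup G) : Set (CompletedGroupRing ℓ G) :=
    J ∩ {y | proj ℓ N y = proj ℓ N x}
  have hT (N) : IsClosed (T N) := by
    have hproj : {y | proj ℓ N y = proj ℓ N x} =
        ⋂ q, {y | (proj ℓ N y).coeff q = (proj ℓ N x).coeff q} :=
      Set.ext fun y => by
        simp only [Set.mem_iInter, Set.mem_ofPred_eq, MonoidAlgebra.ext_iff, Finsupp.ext_iff]
    exact hc.inter <| hproj ▸ isClosed_iInter fun q =>
      isClosed_eq (continuous_coeff_proj N q) continuous_const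
  have hmono {N M : OpenNormalSubgroup G} (h : N ≤ M) : T N ⊆ T M := by
    rintro y ⟨hyJ, hy : proj ℓ N y = proj ℓ N x⟩
    have h' : ∀ g ∈ N.toSubgroup, MonoidHom.id G g ∈ M.toSubgroup := fun _ hg => h hg
    refine ⟨hyJ, show proj ℓ M y = proj ℓ M x from ?_⟩
    rw [← transition_proj y h', hy, transition_proj]
  have : Nonempty (OpenNormalSubgroup G) := ⟨wholeGroup G⟩
  obtain ⟨y, hy⟩ := IsCompact.nonempty_iInter_of_directed_nonempty_isCompact_isClosed T
    (fun N M => ⟨N ⊓ M, hmono inf_le_left, hmono inf_le_right⟩)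
    (exists_mem_proj_eq_of_mem_augIdeal hJ hx) (fun N => (hT N).isCompact) hT
  have hyx : y = x := CompletedGroupRing.ext fun N => (Set.mem_iInter.1 hy N).2
  exact hyx ▸ (Set.mem_iInter.1 hy (wholeGroup G)).1

theorem continuous_sum_mul_of_sub_one (S : Finset G) :
    Continuous fun y : S → CompletedGroupRing ℓ G => ∑ s, y s * (of ℓ s.1 - 1) :=
  continuous_finsetSum _ fun s _ => (continuous_apply s).mul_const _

theorem exists_eq_sum_mul_of_sub_one {S : Finset G}
    (hS : (Subgroup.closure (S : Set G)).topologicalClosure = ⊤) {x : CompletedGroupRing ℓ G}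
    (hx : x ∈ augIdeal ℓ G) :
    ∃ y : S → CompletedGroupRing ℓ G, ∑ s, y s * (of ℓ s.1 - 1) = x := by
  let J := Submodule.span (CompletedGroupRing ℓ G)
    (Set.range fun s : S => of (G := G) ℓ s.1 - 1)
  have hJ : (J : Set (CompletedGroupRing ℓ G)) =
      Set.range fun y : S → CompletedGroupRing ℓ G => ∑ s, y s * (of ℓ s.1 - 1) :=
    Set.ext fun x => Submodule.mem_span_range_iff_exists_fun _
  have hc : IsClosed (J : Set (CompletedGroupRing ℓ G)) :=
    hJ ▸ (isCompact_range (continuous_sum_mul_of_sub_one S)).isClosed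
  have hmem (g : G) : of ℓ g - 1 ∈ J.restrictScalars ℤ_[ℓ] :=
    of_sub_one_mem_of_mem_topologicalClosure (J := J.restrictScalars ℤ_[ℓ])
      (S := (S : Set G)) hc (fun g x hx => J.smul_mem (of ℓ g) hx)
      (fun s hs => Submodule.subset_span ⟨⟨s, hs⟩, rfl⟩)
      (hS ▸ Subgroup.mem_top g)
  exact (Submodule.mem_span_range_iff_exists_fun _).1 (augIdeal_le_of_isClosed hc hmem hx)

theorem coe_augIdeal_pow_succ_eq_image {S : Finset G}
    (hS : (Subgroup.closure (S : Set G)).topologicalClosure = ⊤) (n : ℕ) :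
    ((augIdeal ℓ G ^ (n + 2) : Submodule ℤ_[ℓ] _) : Set (CompletedGroupRing ℓ G)) =
      (fun y : S → CompletedGroupRing ℓ G => ∑ s, y s * (of ℓ s.1 - 1)) ''
        Set.univ.pi fun _ => (augIdeal ℓ G ^ (n + 1) : Submodule ℤ_[ℓ] _) := by
  refine Set.Subset.antisymm (fun x hx => ?_) ?_
  · rw [SetLike.mem_coe, pow_succ _ (n + 1)] at hx
    induction hx using Submodule.mul_induction_on' with
    | mem_mul_mem a ha b hb =>
      obtain ⟨y, rfl⟩ := exists_eq_sum_mul_of_sub_one hS hb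
      exact ⟨fun s => a * y s, fun s _ => augIdeal_pow_mul_mem n ha _, by
        simp only [Finset.mul_sum, mul_assoc]⟩
    | add _ _ _ _ ha hb =>
      obtain ⟨y, hy, rfl⟩ := ha
      obtain ⟨z, hz, rfl⟩ := hb
      exact ⟨y + z, fun s hs => add_mem (hy s hs) (hz s hs), by
        simp only [Pi.add_apply, add_mul, Finset.sum_add_distrib]⟩
  · rintro _ ⟨y, hy, rfl⟩
    rw [pow_succ _ (n + 1)]
    exact Submodule.sum_mem _ fun s _ => Submodule.mul_mem_mul (hy s trivial) (of_sub_one_mem s.1)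

variable [TopologicallyFG G]

theorem isClosed_augIdeal_pow (n : ℕ) :
    IsClosed ((augIdeal ℓ G ^ (n + 1) : Submodule ℤ_[ℓ] (CompletedGroupRing ℓ G)) :
      Set (CompletedGroupRing ℓ G)) := by
  obtain ⟨S, hS⟩ := TopologicallyFG.out (G := G)
  induction n with
  | zero =>
    rw [zero_add, pow_one]
    exact isClosed_singleton.preimage (continuous_augmentation (ℓ := ℓ) (G := G))
  | succ n ih =>
    rw [coe_augIdeal_pow_succ_eq_image hS]
    exact ((isCompact_univ_pi fun _ => ih.isCompact).image
      (continuous_sum_mul_of_sub_one S)).isClosed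

end AugmentationIdeal

/-! ### Finiteness and topology of the subquotients -/

section Subquotients

variable {ℓ : ℕ} [Fact ℓ.Prime] {G : Type u} [Group G] [TopologicalSpace G]

instance (m n : ℕ) : ContinuousSMul ℤ_[ℓ] (AugQuot ℓ G m n) :=
  inferInstanceAs (ContinuousSMul ℤ_[ℓ] (↥(augIdeal ℓ G ^ m) ⧸
    (augIdeal ℓ G ^ n).submoduleOf (augIdeal ℓ G ^ m)))

theorem AugQuot.continuous_mk (m n : ℕ) : Continuous (AugQuot.mk ℓ G m n) := continuous_quot_mk

theorem AugQuot.mk_eq_mk {m n : ℕ} {x y : ↥(augIdeal ℓ G ^ m)} :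
    AugQuot.mk ℓ G m n x = AugQuot.mk ℓ G m n y ↔
      (x - y : CompletedGroupRing ℓ G) ∈ augIdeal ℓ G ^ n := by
  rw [← sub_eq_zero, ← map_sub, AugQuot.mk_eq_zero]
  rfl

theorem mulTensor_surjective : Function.Surjective (mulTensor ℓ G) := by
  rw [← LinearMap.range_eq_top, eq_top_iff]
  rintro u -
  obtain ⟨⟨x, hx⟩, rfl⟩ := AugQuot.mk_surjective u
  have key : ∀ y ∈ augIdeal ℓ G ^ 1 * augIdeal ℓ G ^ 1, ∃ h : y ∈ augIdeal ℓ G ^ 2,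
      AugQuot.mk ℓ G 2 3 ⟨y, h⟩ ∈ LinearMap.range (mulTensor ℓ G) := by
    intro y hy
    induction hy using Submodule.mul_induction_on' with
    | mem_mul_mem a ha b hb =>
      exact ⟨mul_mem_pow ha hb, AugQuot.mk ℓ G 1 2 ⟨a, ha⟩ ⊗ₜ AugQuot.mk ℓ G 1 2 ⟨b, hb⟩,
        by rw [mulTensor, TensorProduct.lift.tmul, mulV_mk]⟩
    | add a _ b _ ha hb =>
      obtain ⟨ha, ha'⟩ := ha
      obtain ⟨hb, hb'⟩ := hb
      exact ⟨add_mem ha hb, (LinearMap.range (mulTensor ℓ G)).add_mem ha' hb'⟩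
  exact (key x (by rwa [← pow_add])).2

variable (ℓ) in
theorem of_sub_one_mem_pow_one (g : G) : of ℓ g - 1 ∈ augIdeal ℓ G ^ 1 :=
  (pow_one (augIdeal ℓ G)).symm ▸ of_sub_one_mem g

variable (ℓ) in
/-- The homomorphism `g ↦ [g] - 1` from `G` to `V = I / I²`, through which `V` is compared with the
abelianization of `G`. -/
noncomputable def groupToV : Additive G →+ V ℓ G :=
  AddMonoidHom.mk' (fun g => AugQuot.mk ℓ G 1 2 ⟨of ℓ g.toMul - 1, of_sub_one_mem_pow_one ℓ _⟩)
    fun g h => by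
      rw [← map_add, AugQuot.mk_eq_mk]
      have e : of ℓ (g.toMul * h.toMul) - 1 - ((of ℓ g.toMul - 1) + (of ℓ h.toMul - 1)) =
          (of ℓ g.toMul - 1) * (of ℓ h.toMul - 1) := by
        rw [map_mul]; noncomm_ring
      change of ℓ (g.toMul * h.toMul) - 1 - ((of ℓ g.toMul - 1) + (of ℓ h.toMul - 1)) ∈ _
      rw [e, pow_two]
      exact Submodule.mul_mem_mul (of_sub_one_mem _) (of_sub_one_mem _)

theorem groupToV_apply (g : G) : groupToV ℓ (.ofMul g) =
    AugQuot.mk ℓ G 1 2 ⟨of ℓ g - 1, of_sub_one_mem_pow_one ℓ g⟩ := rfl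

theorem augRep_mk_of_sub_one (n : ℕ) (σ : ContAut G) (g : G) :
    augRep ℓ G 1 n σ (AugQuot.mk ℓ G 1 n ⟨of ℓ g - 1, of_sub_one_mem_pow_one ℓ g⟩) =
      AugQuot.mk ℓ G 1 n ⟨of ℓ (σ g) - 1, of_sub_one_mem_pow_one ℓ (σ g)⟩ := by
  have h : CompletedGroupRing.map σ (of ℓ g - 1) = of ℓ (σ g) - 1 := by
    rw [map_sub, map_one, map_of]
  rw [augRep_mk]
  exact congrArg (AugQuot.mk ℓ G 1 n) (Subtype.ext h)

theorem augRep_groupToV (σ : ContAut G) (g : G) :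
    augRep ℓ G 1 2 σ (groupToV ℓ (.ofMul g)) = groupToV ℓ (.ofMul (σ g)) :=
  augRep_mk_of_sub_one 2 σ g

variable [IsTopologicalGroup G]

theorem continuous_groupToV : Continuous fun g : G => groupToV ℓ (.ofMul g) :=
  (AugQuot.continuous_mk 1 2).comp ((continuous_of.sub continuous_const).subtype_mk _)

variable [CompactSpace G]

theorem span_groupToV {S : Finset G}
    (hS : (Subgroup.closure (S : Set G)).topologicalClosure = ⊤) :
    Submodule.span ℤ_[ℓ] (Set.range fun s : S => groupToV ℓ (.ofMul s.1)) = ⊤ := by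
  rw [eq_top_iff]
  rintro v -
  obtain ⟨⟨x, hx⟩, rfl⟩ := AugQuot.mk_surjective v
  obtain ⟨y, rfl⟩ := exists_eq_sum_mul_of_sub_one hS (by rwa [pow_one] at hx)
  have h : AugQuot.mk ℓ G 1 2 ⟨∑ s, y s * (of ℓ s.1 - 1), hx⟩ =
      ∑ s, augmentation ℓ G (y s) • groupToV ℓ (.ofMul s.1) := by
    simp only [groupToV_apply, ← map_smul, ← map_sum]
    rw [AugQuot.mk_eq_mk]
    simp only [AddSubmonoidClass.coe_finsetSum, SetLike.val_smul, ← Finset.sum_sub_distrib,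
      Algebra.smul_def, ← sub_mul, pow_two]
    refine Submodule.sum_mem _ fun s _ => Submodule.mul_mem_mul ?_ (of_sub_one_mem s.1)
    change augmentation ℓ G _ = 0
    rw [map_sub, AlgHom.commutes]
    exact sub_self _
  exact h ▸ Submodule.sum_mem _ fun s _ => Submodule.smul_mem _ _ (Submodule.subset_span ⟨s, rfl⟩)

variable [TopologicallyFG G]

instance (m n : ℕ) : T2Space (AugQuot ℓ G m (n + 1)) := by
  have : IsClosed (((augIdeal ℓ G ^ (n + 1)).submoduleOf (augIdeal ℓ G ^ m) :
      Submodule ℤ_[ℓ] ↥(augIdeal ℓ G ^ m)) : Set ↥(augIdeal ℓ G ^ m)) :=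
    (isClosed_augIdeal_pow n).preimage continuous_subtype_val
  exact inferInstanceAs (T2Space (↥(augIdeal ℓ G ^ m) ⧸
    (augIdeal ℓ G ^ (n + 1)).submoduleOf (augIdeal ℓ G ^ m)))

instance : T2Space (V ℓ G) := inferInstanceAs (T2Space (AugQuot ℓ G 1 (1 + 1)))
instance : T2Space (U ℓ G) := inferInstanceAs (T2Space (AugQuot ℓ G 2 (2 + 1)))
instance : T2Space (E ℓ G) := inferInstanceAs (T2Space (AugQuot ℓ G 1 (2 + 1)))

instance : Module.Finite ℤ_[ℓ] (V ℓ G) := by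
  obtain ⟨S, hS⟩ := TopologicallyFG.out (G := G)
  exact ⟨span_groupToV (ℓ := ℓ) hS ▸ Submodule.fg_span (Set.finite_range _)⟩

instance : Module.Finite ℤ_[ℓ] (U ℓ G) :=
  Module.Finite.of_surjective (mulTensor ℓ G) mulTensor_surjective

theorem isClosed_W : IsClosed (W ℓ G : Set (U ℓ G)) :=
  (Submodule.isCompact_of_fg (IsNoetherian.noetherian _)).isClosed

end Subquotients

/-! ### The abelianization, `V` and `W` -/

section Abelianization

theorem smul_mem_of_isClosed {p : ℕ} [Fact p.Prime] {M : Type*} [AddCommGroup M]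
    [Module ℤ_[p] M] [TopologicalSpace M] [ContinuousSMul ℤ_[p] M] {H : AddSubgroup M}
    (hH : IsClosed (H : Set M)) (a : ℤ_[p]) {x : M} (hx : x ∈ H) : a • x ∈ H :=
  PadicInt.denseRange_intCast.induction_on (p := fun a => a • x ∈ H) a
    (hH.preimage (f := fun a : ℤ_[p] => a • x) (by fun_prop)) fun n => by
      rw [Int.cast_smul_eq_zsmul]
      exact H.zsmul_mem hx n

variable (ℓ : ℕ) [Fact ℓ.Prime] (G : Type u) [Group G] [TopologicalSpace G]

/-- The preimage of `W` in `I²`, as a submodule of `ℤ_ℓ[[G]]`. Modulo this submodule `[g]` depends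
only on the image of `g` in the abelianization. -/
noncomputable def preimageW : Submodule ℤ_[ℓ] (CompletedGroupRing ℓ G) :=
  ((W ℓ G).comap (AugQuot.mk ℓ G 2 3)).map (augIdeal ℓ G ^ 2).subtype

variable {ℓ G}

theorem mem_preimageW {x : CompletedGroupRing ℓ G} (hx : x ∈ augIdeal ℓ G ^ 2) :
    x ∈ preimageW ℓ G ↔ AugQuot.mk ℓ G 2 3 ⟨x, hx⟩ ∈ W ℓ G := by
  constructor
  · rintro ⟨y, hy, rfl⟩
    exact hy
  · intro h
    exact ⟨⟨x, hx⟩, h, rfl⟩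

theorem preimageW_le : preimageW ℓ G ≤ augIdeal ℓ G ^ 2 := Submodule.map_subtype_le _ _

theorem augIdeal_pow_three_le_preimageW : augIdeal ℓ G ^ 3 ≤ preimageW ℓ G := fun x hx => by
  rw [mem_preimageW (augIdeal_pow_succ_le 1 hx), AugQuot.mk_eq_zero.2 hx]
  exact Submodule.zero_mem _

theorem of_mul_mem_preimageW (g : G) {x : CompletedGroupRing ℓ G} (hx : x ∈ preimageW ℓ G) :
    of ℓ g * x ∈ preimageW ℓ G := by
  have e : of ℓ g * x = (of ℓ g - 1) * x + x := by rw [sub_mul, one_mul, sub_add_cancel]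
  exact e ▸ add_mem (augIdeal_pow_three_le_preimageW
    (mul_mem_pow (m := 1) (n := 2) (of_sub_one_mem_pow_one ℓ g) (preimageW_le hx))) hx

theorem mul_sub_mul_mem_preimageW {x y : CompletedGroupRing ℓ G} (hx : x ∈ augIdeal ℓ G)
    (hy : y ∈ augIdeal ℓ G) : x * y - y * x ∈ preimageW ℓ G := by
  have hx' : x ∈ augIdeal ℓ G ^ 1 := by rwa [pow_one]
  have hy' : y ∈ augIdeal ℓ G ^ 1 := by rwa [pow_one]
  rw [mem_preimageW (sub_mem (mul_mem_pow hx' hy') (mul_mem_pow hy' hx'))]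
  exact commutatorMap_mem ℓ G (AugQuot.mk ℓ G 1 2 ⟨x, hx'⟩) (AugQuot.mk ℓ G 1 2 ⟨y, hy'⟩)

theorem of_commutator_sub_one_mem_preimageW (a b : G) : of ℓ ⁅a, b⁆ - 1 ∈ preimageW ℓ G := by
  have e : of ℓ ⁅a, b⁆ - 1 = of ℓ (a * b) * ((of ℓ a⁻¹ - 1) * (of ℓ b⁻¹ - 1) -
      (of ℓ b⁻¹ - 1) * (of ℓ a⁻¹ - 1)) := by
    have hsub : (of ℓ a⁻¹ - 1) * (of ℓ b⁻¹ - 1) - (of ℓ b⁻¹ - 1) * (of ℓ a⁻¹ - 1) =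
        of ℓ (a⁻¹ * b⁻¹) - of ℓ (b⁻¹ * a⁻¹) := by
      rw [map_mul, map_mul]; noncomm_ring
    rw [hsub, mul_sub, ← map_mul, ← map_mul, ← mul_inv_rev a b, mul_inv_cancel, map_one,
      commutatorElement_def, mul_assoc (a * b)]
  exact e ▸ of_mul_mem_preimageW _
    (mul_sub_mul_mem_preimageW (of_sub_one_mem a⁻¹) (of_sub_one_mem b⁻¹))

variable [IsTopologicalGroup G] [CompactSpace G] [TopologicallyFG G]

theorem isClosed_preimageW : IsClosed (preimageW ℓ G : Set (CompletedGroupRing ℓ G)) := by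
  rw [preimageW, Submodule.map_coe]
  exact (isClosed_augIdeal_pow 1).isClosedEmbedding_subtypeVal.isClosedMap _
    (isClosed_W.preimage (AugQuot.continuous_mk 2 3))

theorem of_sub_of_mem_preimageW {g h : G}
    (H : (g : TopologicalAbelianization G) = (h : TopologicalAbelianization G)) :
    of ℓ g - of ℓ h ∈ preimageW ℓ G := by
  have hc : h⁻¹ * g ∈ (commutator G).topologicalClosure := QuotientGroup.eq.1 H.symm
  rw [commutator_eq_closure] at hc
  have hw : of ℓ (h⁻¹ * g) - 1 ∈ preimageW ℓ G :=
    of_sub_one_mem_of_mem_topologicalClosure isClosed_preimageW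
      (fun g x hx => of_mul_mem_preimageW g hx)
      (by rintro _ ⟨a, b, rfl⟩; exact of_commutator_sub_one_mem_preimageW a b) hc
  have e : of ℓ g - of ℓ h = of ℓ h * (of ℓ (h⁻¹ * g) - 1) := by
    rw [mul_sub, ← map_mul, mul_inv_cancel_left, mul_one]
  exact e ▸ of_mul_mem_preimageW h hw

theorem groupToV_congr {g h : G}
    (H : (g : TopologicalAbelianization G) = (h : TopologicalAbelianization G)) :
    groupToV ℓ (.ofMul g) = groupToV ℓ (.ofMul h) := by
  rw [groupToV_apply, groupToV_apply, AugQuot.mk_eq_mk, sub_sub_sub_cancel_right]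
  exact preimageW_le (of_sub_of_mem_preimageW H)

theorem groupToV_surjective : Function.Surjective (groupToV ℓ : Additive G → V ℓ G) := by
  have hcl : IsClosed ((groupToV ℓ (G := G)).range : Set (V ℓ G)) :=
    (isCompact_range continuous_groupToV).isClosed
  let P : Submodule ℤ_[ℓ] (V ℓ G) :=
    { (groupToV ℓ).range with smul_mem' := fun a _ hx => smul_mem_of_isClosed hcl a hx }
  obtain ⟨S, hS⟩ := TopologicallyFG.out (G := G)
  have hP : (⊤ : Submodule ℤ_[ℓ] (V ℓ G)) ≤ P := by
    rw [← span_groupToV hS, Submodule.span_le]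
    rintro _ ⟨s, rfl⟩
    exact ⟨.ofMul s.1, rfl⟩
  exact fun v => hP (Submodule.mem_top (x := v))

end Abelianization

/-! ### Homomorphisms extended to the group algebra -/

section LinearExtension

variable {R Q M : Type*} [CommRing R] [AddCommGroup M] [Module R M]

/-- The linear extension to the group algebra of a function on the group. -/
noncomputable def linearExtension (F : Q → M) : MonoidAlgebra R Q →ₗ[R] M :=
  Finsupp.linearCombination R F ∘ₗ (MonoidAlgebra.coeffLinearEquiv R).toLinearMap

theorem linearExtension_single (F : Q → M) (q : Q) (a : R) :
    linearExtension F (MonoidAlgebra.single q a) = a • F q :=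
  Finsupp.linearCombination_single R a q

variable [Group Q] {F : Q → M}

theorem linearExtension_mul (hF : ∀ p q, F (p * q) = F p + F q) (x y : MonoidAlgebra R Q) :
    linearExtension F (x * y) = MonoidAlgebra.lift R R Q 1 y • linearExtension F x +
      MonoidAlgebra.lift R R Q 1 x • linearExtension F y := by
  induction x using MonoidAlgebra.induction_linear with
  | zero => simp
  | add a b ha hb => simp only [add_mul, map_add, ha, hb, smul_add, add_smul]; abel
  | single p a =>
    induction y using MonoidAlgebra.induction_linear with
    | zero => simp
    | add c d hc hd => simp only [mul_add, map_add, hc, hd, smul_add, add_smul]; abel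
    | single q b =>
      simp only [MonoidAlgebra.single_mul_single, linearExtension_single, hF,
        MonoidAlgebra.lift_single, MonoidHom.one_apply, smul_add, smul_smul, smul_eq_mul, mul_one]
      rw [mul_comm b a]

theorem linearExtension_tmul_self_mul (hF : ∀ p q, F (p * q) = F p + F q)
    (x y : MonoidAlgebra R Q) :
    linearExtension (fun q => F q ⊗ₜ[R] F q) (x * y) =
      MonoidAlgebra.lift R R Q 1 y • linearExtension (fun q => F q ⊗ₜ[R] F q) x +
      MonoidAlgebra.lift R R Q 1 x • linearExtension (fun q => F q ⊗ₜ[R] F q) y +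
      (linearExtension F x ⊗ₜ[R] linearExtension F y +
        linearExtension F y ⊗ₜ[R] linearExtension F x) := by
  induction x using MonoidAlgebra.induction_linear with
  | zero => simp
  | add a b ha hb =>
    simp only [add_mul, map_add, ha, hb, smul_add, add_smul, TensorProduct.tmul_add,
      TensorProduct.add_tmul]
    abel
  | single p a =>
    induction y using MonoidAlgebra.induction_linear with
    | zero => simp
    | add c d hc hd =>
      simp only [mul_add, map_add, hc, hd, smul_add, add_smul, TensorProduct.tmul_add,
        TensorProduct.add_tmul]
      abel
    | single q b =>
      simp only [MonoidAlgebra.single_mul_single, linearExtension_single, hF,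
        MonoidAlgebra.lift_single, MonoidHom.one_apply, smul_eq_mul, mul_one, smul_smul, smul_add,
        TensorProduct.tmul_add, TensorProduct.add_tmul, TensorProduct.smul_tmul_smul]
      rw [mul_comm b a]
      abel

end LinearExtension

/-! ### Homomorphisms with open kernel -/

section OpenKernel

variable {ℓ : ℕ} [Fact ℓ.Prime] {G : Type u} [Group G] [TopologicalSpace G] {M : Type*}
  [AddCommGroup M] [Module ℤ_[ℓ] M]

theorem linearExtension_proj_of_sub_one {N : OpenNormalSubgroup G} {F : G ⧸ N.toSubgroup → M}
    (hF : ∀ p q, F (p * q) = F p + F q) (g : G) :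
    linearExtension F (proj ℓ N (of ℓ g - 1)) = F g := by
  have hF1 : F 1 = 0 := by simpa using hF 1 1
  rw [map_sub, map_sub, map_one, proj_of, MonoidAlgebra.one_def, linearExtension_single,
    linearExtension_single, hF1, one_smul, one_smul, sub_zero]

theorem linearExtension_proj_eq_zero {N : OpenNormalSubgroup G} {F : G ⧸ N.toSubgroup → M}
    (hF : ∀ p q, F (p * q) = F p + F q) {x : CompletedGroupRing ℓ G} (hx : x ∈ augIdeal ℓ G ^ 2) :
    linearExtension F (proj ℓ N x) = 0 := by
  rw [pow_two] at hx
  induction hx using Submodule.mul_induction_on' with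
  | mem_mul_mem a ha b hb =>
    have ha0 : augmentation ℓ G a = 0 := ha
    have hb0 : augmentation ℓ G b = 0 := hb
    rw [map_mul, linearExtension_mul hF, ← augmentation_eq_lift_one_proj,
      ← augmentation_eq_lift_one_proj, ha0, hb0, zero_smul, zero_smul, add_zero]
  | add a _ b _ ha hb => rw [map_add, map_add, ha, hb, add_zero]

theorem linearExtension_tmul_self_proj_mul {N : OpenNormalSubgroup G} {F : G ⧸ N.toSubgroup → M}
    (hF : ∀ p q, F (p * q) = F p + F q) {x y : CompletedGroupRing ℓ G} (hx : x ∈ augIdeal ℓ G)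
    (hy : y ∈ augIdeal ℓ G) :
    linearExtension (fun q => F q ⊗ₜ[ℤ_[ℓ]] F q) (proj ℓ N (x * y)) =
      linearExtension F (proj ℓ N x) ⊗ₜ[ℤ_[ℓ]] linearExtension F (proj ℓ N y) +
        linearExtension F (proj ℓ N y) ⊗ₜ[ℤ_[ℓ]] linearExtension F (proj ℓ N x) := by
  have hx0 : augmentation ℓ G x = 0 := hx
  have hy0 : augmentation ℓ G y = 0 := hy
  rw [map_mul, linearExtension_tmul_self_mul hF, ← augmentation_eq_lift_one_proj,
    ← augmentation_eq_lift_one_proj, hx0, hy0, zero_smul, zero_smul, add_zero, zero_add]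

theorem linearExtension_tmul_self_proj_eq_zero {N : OpenNormalSubgroup G}
    {F : G ⧸ N.toSubgroup → M} (hF : ∀ p q, F (p * q) = F p + F q) {x : CompletedGroupRing ℓ G}
    (hx : x ∈ augIdeal ℓ G ^ 3) :
    linearExtension (fun q => F q ⊗ₜ[ℤ_[ℓ]] F q) (proj ℓ N x) = 0 := by
  rw [pow_succ _ 2] at hx
  induction hx using Submodule.mul_induction_on' with
  | mem_mul_mem a ha b hb =>
    rw [linearExtension_tmul_self_proj_mul hF (augIdeal_sq_le ha) hb,
      linearExtension_proj_eq_zero hF ha, TensorProduct.zero_tmul, TensorProduct.tmul_zero,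
      add_zero]
  | add a _ b _ ha hb => rw [map_add, map_add, ha, hb, add_zero]

theorem exists_openNormalSubgroup_factor {f : Additive G →+ M}
    (hf : IsOpen {g : G | f (.ofMul g) = 0}) :
    ∃ (N : OpenNormalSubgroup G) (F : G ⧸ N.toSubgroup → M),
      (∀ p q, F (p * q) = F p + F q) ∧ ∀ g : G, F g = f (.ofMul g) :=
  let φ : G →* Multiplicative M := f.toMultiplicativeRight
  ⟨⟨⟨φ.ker, hf⟩, inferInstanceAs φ.ker.Normal⟩, fun q => (QuotientGroup.kerLift φ q).toAdd,
    fun p q => congrArg Multiplicative.toAdd (map_mul (QuotientGroup.kerLift φ) p q), fun _ => rfl⟩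

theorem exists_linearMap_groupToV_eq {f : Additive G →+ M}
    (hf : IsOpen {g : G | f (.ofMul g) = 0}) :
    ∃ L : V ℓ G →ₗ[ℤ_[ℓ]] M, ∀ g, L (groupToV ℓ g) = f g := by
  obtain ⟨N, F, hF, hFf⟩ := exists_openNormalSubgroup_factor hf
  refine ⟨AugQuot.lift (linearExtension F ∘ₗ (proj ℓ N).toLinearMap ∘ₗ (augIdeal ℓ G ^ 1).subtype)
    fun x hx => linearExtension_proj_eq_zero hF hx, fun g => ?_⟩
  exact (linearExtension_proj_of_sub_one hF g.toMul).trans (hFf g.toMul)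

theorem exists_linearMap_mulV_groupToV_eq {f : Additive G →+ M}
    (hf : IsOpen {g : G | f (.ofMul g) = 0}) :
    ∃ Φ : U ℓ G →ₗ[ℤ_[ℓ]] M ⊗[ℤ_[ℓ]] M, ∀ g h,
      Φ (mulV ℓ G (groupToV ℓ g) (groupToV ℓ h)) = f g ⊗ₜ f h + f h ⊗ₜ f g := by
  obtain ⟨N, F, hF, hFf⟩ := exists_openNormalSubgroup_factor hf
  refine ⟨AugQuot.lift (linearExtension (fun q => F q ⊗ₜ[ℤ_[ℓ]] F q) ∘ₗ (proj ℓ N).toLinearMap ∘ₗ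
    (augIdeal ℓ G ^ 2).subtype) fun x hx => linearExtension_tmul_self_proj_eq_zero hF hx,
    fun g h => ?_⟩
  refine (linearExtension_tmul_self_proj_mul hF (of_sub_one_mem g.toMul)
    (of_sub_one_mem h.toMul)).trans ?_
  rw [linearExtension_proj_of_sub_one hF, linearExtension_proj_of_sub_one hF, hFf, hFf]
  rfl

end OpenKernel

/-! ### Torsion-freeness of `V` -/

section TorsionFree

variable {ℓ : ℕ} [Fact ℓ.Prime] {G : Type u} [Group G] [TopologicalSpace G]

theorem mem_of_groupToV_eq_zero {N : OpenNormalSubgroup G} (hN : commutator G ≤ N.toSubgroup)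
    [Finite (G ⧸ N.toSubgroup)] (hp : IsPGroup ℓ (G ⧸ N.toSubgroup)) {h : G}
    (hh : groupToV ℓ (.ofMul h) = 0) : h ∈ N.toSubgroup := by
  let _ : CommGroup (G ⧸ N.toSubgroup) :=
    { (inferInstance : Group (G ⧸ N.toSubgroup)) with
      mul_comm := (Subgroup.Normal.quotient_commutative_iff_commutator_le.2 hN).is_comm.comm }
  obtain ⟨k, hk⟩ := IsPGroup.iff_card.1 hp
  let _ : Module (ZMod (ℓ ^ k)) (Additive (G ⧸ N.toSubgroup)) :=
    AddCommGroup.zmodModule fun x => hk ▸ pow_card_eq_one' (x := x.toMul)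
  let _ : Module ℤ_[ℓ] (Additive (G ⧸ N.toSubgroup)) := Module.compHom _ (PadicInt.toZModPow k)
  let f : Additive G →+ Additive (G ⧸ N.toSubgroup) :=
    (QuotientGroup.mk' N.toSubgroup).toAdditive
  have hf (g : G) : f (.ofMul g) = 0 ↔ g ∈ N.toSubgroup := QuotientGroup.eq_one_iff g
  obtain ⟨L, hL⟩ := exists_linearMap_groupToV_eq (ℓ := ℓ) (f := f)
    (Set.ext hf ▸ N.isOpen')
  rw [← hf, ← hL, hh, map_zero]

variable [IsTopologicalGroup G] [CompactSpace G]

theorem mem_closure_commutator_of_groupToV_eq_zero [TotallyDisconnectedSpace G]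
    (hG : ∀ N : OpenNormalSubgroup G, IsPGroup ℓ (G ⧸ N.toSubgroup)) {h : G}
    (hh : groupToV ℓ (.ofMul h) = 0) : h ∈ (commutator G).topologicalClosure := by
  by_contra hn
  have hopen : IsOpen {g : G | h * g ∈ ((commutator G).topologicalClosure : Set G)ᶜ} :=
    (Subgroup.isClosed_topologicalClosure _).isOpen_compl.preimage (continuous_const_mul h)
  obtain ⟨N, hN⟩ := ProfiniteGrp.exist_openNormalSubgroup_sub_open_nhds_of_one hopen
    (by rwa [Set.mem_ofPred_eq, mul_one])
  let M : OpenNormalSubgroup G :=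
    { toOpenSubgroup := ⟨commutator G ⊔ N.toSubgroup,
        Subgroup.isOpen_mono le_sup_right N.isOpen'⟩
      isNormal' := inferInstanceAs (commutator G ⊔ N.toSubgroup).Normal }
  have : Finite (G ⧸ M.toSubgroup) := finite_quotient M
  have hM : h ∈ commutator G ⊔ N.toSubgroup :=
    mem_of_groupToV_eq_zero (N := M) le_sup_left (hG M) hh
  obtain ⟨c, hc, n, hn', rfl⟩ := Subgroup.mem_sup_of_normal_right.1 hM
  refine hN (N.toSubgroup.inv_mem hn') ?_
  rw [mul_inv_cancel_right]
  exact Subgroup.le_topologicalClosure _ hc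

theorem isTorsionFree_V [TotallyDisconnectedSpace G] [TopologicallyFG G]
    (hG : ∀ N : OpenNormalSubgroup G, IsPGroup ℓ (G ⧸ N.toSubgroup))
    (htf : IsMulTorsionFree (TopologicalAbelianization G)) :
    Module.IsTorsionFree ℤ_[ℓ] (V ℓ G) := by
  refine Module.IsTorsionFree.of_smul_eq_zero fun a v h => or_iff_not_imp_left.2 fun ha => ?_
  obtain ⟨g, rfl⟩ := groupToV_surjective v
  rw [PadicInt.unitCoeff_spec ha, mul_smul] at h
  have hpow : groupToV ℓ (.ofMul (g.toMul ^ ℓ ^ a.valuation)) = 0 := by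
    rw [ofMul_pow, map_nsmul, ← Nat.cast_smul_eq_nsmul ℤ_[ℓ], Nat.cast_pow]
    exact (PadicInt.unitCoeff ha).isUnit.smul_eq_zero.1 h
  have hmk : (g.toMul : TopologicalAbelianization G) ^ ℓ ^ a.valuation = 1 ^ ℓ ^ a.valuation := by
    rw [one_pow]
    exact (QuotientGroup.eq_one_iff _).2 (mem_closure_commutator_of_groupToV_eq_zero hG hpow)
  have h1 : (g.toMul : TopologicalAbelianization G) = (1 : G) :=
    htf.pow_left_injective (pow_ne_zero _ (Fact.out : ℓ.Prime).ne_zero) hmk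
  exact (groupToV_congr h1).trans (map_zero (groupToV ℓ))

end TorsionFree

/-! ### The kernel of multiplication and the `2`-torsion of `U / W` -/

section LocalAlgebra

variable {R M : Type*} [CommRing R] [AddCommGroup M] [Module R M]

theorem ker_map_mkQ_smul_top_le (I : Ideal R) :
    LinearMap.ker (TensorProduct.map (I • ⊤ : Submodule R M).mkQ (I • ⊤ : Submodule R M).mkQ) ≤
      I • (⊤ : Submodule R (M ⊗[R] M)) := by
  have hexact := LinearMap.exact_subtype_mkQ (I • ⊤ : Submodule R M)
  have hsurj := Submodule.mkQ_surjective (I • ⊤ : Submodule R M)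
  rw [TensorProduct.map_ker hexact hsurj hexact hsurj, sup_le_iff]
  constructor
  · rintro _ ⟨t, rfl⟩
    induction t using TensorProduct.induction_on with
    | zero => simp
    | add t u ht hu => simpa only [map_add] using add_mem ht hu
    | tmul x y => exact Submodule.smul_top_le_comap_smul_top I (TensorProduct.mk R M M x) y.2
  · rintro _ ⟨t, rfl⟩
    induction t using TensorProduct.induction_on with
    | zero => simp
    | add t u ht hu => simpa only [map_add] using add_mem ht hu
    | tmul x y =>
      exact Submodule.smul_top_le_comap_smul_top I ((TensorProduct.mk R M M).flip y) x.2

theorem eq_zero_of_forall_map_mkQ_pow_smul_eq_zero [IsLocalRing R] [IsNoetherianRing R]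
    [Module.Finite R M] {I : Ideal R} (hI : I ≠ ⊤) {t : M ⊗[R] M}
    (ht : ∀ n, TensorProduct.map (I ^ n • ⊤ : Submodule R M).mkQ (I ^ n • ⊤ : Submodule R M).mkQ
      t = 0) : t = 0 := by
  rw [← Submodule.mem_bot R, ← Ideal.iInf_pow_smul_eq_bot_of_isLocalRing I hI, Submodule.mem_iInf]
  exact fun n => ker_map_mkQ_smul_top_le (I ^ n) (ht n)

theorem isOpen_of_finite_quotient [IsNoetherianRing R] [TopologicalSpace R] [CompactSpace R]
    [Module.Finite R M] [TopologicalSpace M] [IsTopologicalAddGroup M] [ContinuousSMul R M]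
    [T2Space M] (P : Submodule R M) [hP : Finite (M ⧸ P)] : IsOpen (P : Set M) := by
  have : P.toAddSubgroup.FiniteIndex :=
    @AddSubgroup.finiteIndex_of_finite_quotient _ _ P.toAddSubgroup hP
  exact P.toAddSubgroup.isOpen_of_isClosed_of_finiteIndex
    (Submodule.isCompact_of_fg (IsNoetherian.noetherian P)).isClosed

end LocalAlgebra

section TwoTorsion

variable {ℓ : ℕ} [Fact ℓ.Prime] {G : Type u} [Group G] [TopologicalSpace G]
  [IsTopologicalGroup G] [CompactSpace G] [TopologicallyFG G]

theorem map_mkQ_add_comm_eq_zero {P : Submodule ℤ_[ℓ] (V ℓ G)} (hP : IsOpen (P : Set (V ℓ G)))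
    {t : V ℓ G ⊗[ℤ_[ℓ]] V ℓ G} (ht : mulTensor ℓ G t = 0) :
    TensorProduct.map P.mkQ P.mkQ (t + TensorProduct.comm ℤ_[ℓ] _ _ t) = 0 := by
  obtain ⟨Φ, hΦ⟩ := exists_linearMap_mulV_groupToV_eq (ℓ := ℓ)
    (f := P.mkQ.toAddMonoidHom.comp (groupToV ℓ : Additive G →+ V ℓ G))
    (by
      have : {g : G | P.mkQ (groupToV ℓ (.ofMul g)) = 0} = (fun g => groupToV ℓ (.ofMul g)) ⁻¹' P :=
        Set.ext fun g => Submodule.Quotient.mk_eq_zero P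
      exact this ▸ hP.preimage continuous_groupToV)
  have key : TensorProduct.map P.mkQ P.mkQ ∘ₗ
      (LinearMap.id + (TensorProduct.comm ℤ_[ℓ] (V ℓ G) (V ℓ G)).toLinearMap) =
        Φ ∘ₗ mulTensor ℓ G := by
    refine TensorProduct.ext' fun v w => ?_
    obtain ⟨g, rfl⟩ := groupToV_surjective v
    obtain ⟨h, rfl⟩ := groupToV_surjective w
    exact (map_add _ _ _).trans (hΦ g h).symm
  exact (LinearMap.congr_fun key t).trans (by rw [LinearMap.comp_apply, ht, map_zero])

theorem ker_mulTensor_le_altTensors : LinearMap.ker (mulTensor ℓ G) ≤ altTensors ℓ G := by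
  intro t ht
  let I := IsLocalRing.maximalIdeal ℤ_[ℓ]
  refine (neg_eq_of_add_eq_zero_right (eq_zero_of_forall_map_mkQ_pow_smul_eq_zero (I := I)
    (Ideal.IsPrime.ne_top inferInstance) fun n => ?_)).symm
  have := Ideal.finite_quotient_pow (IsNoetherian.noetherian I) n
  have := Submodule.finite_quotient_smul (M := V ℓ G) (I ^ n) (N := ⊤) Module.Finite.fg_top
  exact map_mkQ_add_comm_eq_zero (isOpen_of_finite_quotient _) ht

theorem mem_W_of_two_smul_mem [Module.Free ℤ_[ℓ] (V ℓ G)] {u : U ℓ G}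
    (hu : (2 : ℤ_[ℓ]) • u ∈ W ℓ G) : u ∈ W ℓ G := by
  obtain ⟨t, rfl⟩ := mulTensor_surjective u
  obtain ⟨s, hs, hst⟩ := hu
  have hker : (2 : ℤ_[ℓ]) • t - s ∈ altTensors ℓ G := ker_mulTensor_le_altTensors <| by
    rw [LinearMap.mem_ker, map_sub, map_smul, hst, sub_self]
  have h2t : (2 : ℤ_[ℓ]) • t ∈ altTensors ℓ G := by simpa using add_mem hker hs
  refine ⟨t, smul_right_injective _ (two_ne_zero (α := ℤ_[ℓ])) ?_, rfl⟩
  simpa [altTensors] using h2t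

end TwoTorsion

/-! ### The extension of `V` by `U` -/

section Extension

variable {ℓ : ℕ} [Fact ℓ.Prime] {G : Type u} [Group G] [TopologicalSpace G]

theorem inclUE_mk (x : ↥(augIdeal ℓ G ^ 2)) : inclUE ℓ G (AugQuot.mk ℓ G 2 3 x) =
    AugQuot.mk ℓ G 1 3 (Submodule.inclusion (augIdeal_pow_succ_le 0) x) := rfl

theorem projEV_mk (x : ↥(augIdeal ℓ G ^ 1)) :
    projEV ℓ G (AugQuot.mk ℓ G 1 3 x) = AugQuot.mk ℓ G 1 2 x := rfl

theorem inclUE_injective : Function.Injective (inclUE ℓ G) := by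
  refine (injective_iff_map_eq_zero _).2 fun u hu => ?_
  obtain ⟨x, rfl⟩ := AugQuot.mk_surjective u
  rw [inclUE_mk, AugQuot.mk_eq_zero] at hu
  exact AugQuot.mk_eq_zero.2 hu

theorem projEV_surjective : Function.Surjective (projEV ℓ G) := fun v => by
  obtain ⟨x, rfl⟩ := AugQuot.mk_surjective v
  exact ⟨AugQuot.mk ℓ G 1 3 x, rfl⟩

theorem mem_range_inclUE {e : E ℓ G} (he : projEV ℓ G e = 0) :
    e ∈ LinearMap.range (inclUE ℓ G) := by
  obtain ⟨x, rfl⟩ := AugQuot.mk_surjective e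
  rw [projEV_mk, AugQuot.mk_eq_zero] at he
  exact ⟨AugQuot.mk ℓ G 2 3 ⟨x.1, he⟩, rfl⟩

theorem augRep_inclUE (σ : ContAut G) (u : U ℓ G) :
    augRep ℓ G 1 3 σ (inclUE ℓ G u) = inclUE ℓ G (augRep ℓ G 2 3 σ u) := by
  obtain ⟨x, rfl⟩ := AugQuot.mk_surjective u
  rw [inclUE_mk, augRep_mk, augRep_mk, inclUE_mk]
  rfl

theorem projEV_augRep (σ : ContAut G) (e : E ℓ G) :
    projEV ℓ G (augRep ℓ G 1 3 σ e) = augRep ℓ G 1 2 σ (projEV ℓ G e) := by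
  obtain ⟨x, rfl⟩ := AugQuot.mk_surjective e
  rw [augRep_mk, projEV_mk, projEV_mk, augRep_mk]

theorem mem_range_compRight_inclUE {P : Type*} [AddCommGroup P] [Module ℤ_[ℓ] P]
    {d : P →ₗ[ℤ_[ℓ]] E ℓ G} (hd : ∀ v, projEV ℓ G (d v) = 0) :
    d ∈ LinearMap.range (LinearMap.compRight ℤ_[ℓ] (M := P) (inclUE ℓ G)) :=
  ⟨d.codRestrictOfInjective _ inclUE_injective fun v => mem_range_inclUE (hd v),
    LinearMap.codRestrictOfInjective_comp _ _ _ _⟩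

theorem compRight_inclUE_injective {P : Type*} [AddCommGroup P] [Module ℤ_[ℓ] P] :
    Function.Injective (LinearMap.compRight ℤ_[ℓ] (M := P) (inclUE ℓ G)) := fun _ _ h =>
  LinearMap.ext fun v => inclUE_injective (LinearMap.congr_fun h v)

theorem augRep_conj_sub [IsTopologicalGroup G] (g : G) (e : E ℓ G) :
    augRep ℓ G 1 3 (conj g) e - e =
      inclUE ℓ G (commutatorMap ℓ G (groupToV ℓ (.ofMul g)) (projEV ℓ G e)) := by
  obtain ⟨x, rfl⟩ := AugQuot.mk_surjective e
  have key : CompletedGroupRing.map (conj g) x.1 - x.1 -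
      ((of ℓ g - 1) * x.1 - x.1 * (of ℓ g - 1)) =
      ((of ℓ g - 1) * x.1 - x.1 * (of ℓ g - 1)) * (of ℓ g⁻¹ - 1) := by
    have hgb : of ℓ g * of ℓ g⁻¹ = 1 := by rw [← map_mul, mul_inv_cancel, map_one]
    have h : CompletedGroupRing.map (conj g) x.1 - x.1 =
        of ℓ g * x.1 * of ℓ g⁻¹ - x.1 * (of ℓ g * of ℓ g⁻¹) := by
      rw [hgb, mul_one, map_conj]
    rw [h]
    noncomm_ring
  rw [projEV_mk, groupToV_apply, commutatorMap_apply, mulV_mk, mulV_mk, ← map_sub, inclUE_mk,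
    augRep_mk, ← map_sub, AugQuot.mk_eq_mk]
  change CompletedGroupRing.map (conj g) x.1 - x.1 -
    ((of ℓ g - 1) * x.1 - x.1 * (of ℓ g - 1)) ∈ augIdeal ℓ G ^ 3
  rw [key]
  have hg := of_sub_one_mem_pow_one ℓ g
  exact mul_mem_pow (m := 2) (n := 1) (sub_mem (mul_mem_pow hg x.2) (mul_mem_pow x.2 hg))
    (of_sub_one_mem_pow_one ℓ _)

variable [IsTopologicalGroup G] [CompactSpace G] [TopologicallyFG G]

theorem continuous_linHom_augRep_apply {m n : ℕ} (t : V ℓ G →ₗ[ℤ_[ℓ]] AugQuot ℓ G m n) :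
    Continuous fun σ => (augRep ℓ G 1 2).linHom (augRep ℓ G m n) σ t := by
  refine continuous_induced_rng.2 (continuous_pi fun v => ?_)
  have ht : Continuous t := continuous_linearMap_of_finite t
  have h : Continuous fun σ : ContAut G => (σ, t (augRep ℓ G 1 2 σ⁻¹ v)) :=
    continuous_id.prodMk (ht.comp (continuous_augRep_inv ℓ 1 2 v))
  change Continuous fun σ : ContAut G => augRep ℓ G m n σ (t (augRep ℓ G 1 2 σ⁻¹ v))
  simpa only [Function.comp_def] using (continuous_augRep (G := G) ℓ m n).comp h

end Extension

/-! ### Linear maps with values in `W` -/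

section Inclusion

variable {ℓ : ℕ} [Fact ℓ.Prime] {G : Type u} [Group G] [TopologicalSpace G]

theorem isInducing_inclHom : IsInducing (inclHom ℓ G) :=
  isInducing_compRight (f := (W ℓ G).subtype) IsInducing.subtypeVal

theorem inclHom_injective : Function.Injective (inclHom ℓ G) := fun _ _ h =>
  LinearMap.ext fun v => Subtype.ext (LinearMap.congr_fun h v)

theorem mem_range_inclHom {f : HomVU ℓ G} :
    f ∈ LinearMap.range (inclHom ℓ G) ↔ ∀ v, f v ∈ W ℓ G := by
  refine ⟨?_, fun hf => ⟨f.codRestrict _ hf, rfl⟩⟩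
  rintro ⟨h, rfl⟩ v
  exact (h v).2

theorem inclA_injective : Function.Injective (inclA ℓ G) := by
  refine (injective_iff_map_eq_zero _).2 fun x hx => ?_
  induction x using Submodule.Quotient.induction_on with
  | H f =>
    obtain ⟨v, hv⟩ := (Submodule.Quotient.mk_eq_zero _).1 hx
    exact (Submodule.Quotient.mk_eq_zero _).2 ⟨v, inclHom_injective hv⟩

theorem mk_mem_range_inclA {f : HomVU ℓ G} :
    (Submodule.Quotient.mk f : A ℓ G) ∈ LinearMap.range (inclA ℓ G) ↔ ∀ v, f v ∈ W ℓ G := by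
  rw [← mem_range_inclHom]
  constructor
  · rintro ⟨a, ha⟩
    obtain ⟨h, rfl⟩ := Submodule.Quotient.mk_surjective _ a
    obtain ⟨x, hx⟩ := (Submodule.Quotient.eq _).1 ha
    exact ⟨h - commutatorMapW ℓ G x, by
      rw [map_sub, inclHom_commutatorMapW, hx, sub_sub_cancel]⟩
  · rintro ⟨h, rfl⟩
    exact ⟨Submodule.Quotient.mk h, rfl⟩

variable [IsTopologicalGroup G] [CompactSpace G] [TopologicallyFG G] [Module.Free ℤ_[ℓ] (V ℓ G)]

theorem mem_range_inclHom_of_two_smul_mem {f : HomVU ℓ G}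
    (hf : (2 : ℤ_[ℓ]) • f ∈ LinearMap.range (inclHom ℓ G)) : f ∈ LinearMap.range (inclHom ℓ G) :=
  mem_range_inclHom.2 fun v => mem_W_of_two_smul_mem (mem_range_inclHom.1 hf v)

theorem mem_range_inclA_of_two_smul_mem {a : A ℓ G}
    (ha : (2 : ℤ_[ℓ]) • a ∈ LinearMap.range (inclA ℓ G)) : a ∈ LinearMap.range (inclA ℓ G) := by
  obtain ⟨f, rfl⟩ := Submodule.Quotient.mk_surjective _ a
  rw [← Submodule.Quotient.mk_smul] at ha
  exact mk_mem_range_inclA.2 fun v => mem_W_of_two_smul_mem (mk_mem_range_inclA.1 ha v)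

end Inclusion

/-! ### The modified diagonal class and the Johnson class -/

section Classes

variable {ℓ : ℕ} [Fact ℓ.Prime] {G : Type u} [Group G] [TopologicalSpace G]

/-- `z` is the cocycle `σ ↦ σ s σ⁻¹ - s` that the section `s` of `E → V` defines, read in
`Hom(V, U)`. -/
def IsSectionCocycle (s : V ℓ G →ₗ[ℤ_[ℓ]] E ℓ G) (z : Z1 (repHomVU ℓ G)) : Prop :=
  ∀ σ v, inclUE ℓ G (z.1 σ v) = augRep ℓ G 1 3 σ (s (augRep ℓ G 1 2 σ⁻¹ v)) - s v

theorem isModifiedDiagonalClass_unique {c c' : H1 (repHomVU ℓ G)}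
    (hc : IsModifiedDiagonalClass ℓ G c) (hc' : IsModifiedDiagonalClass ℓ G c') : c = c' := by
  obtain ⟨s, z, hs, hz, rfl⟩ := hc
  obtain ⟨s', z', hs', hz', rfl⟩ := hc'
  obtain ⟨t, ht⟩ := mem_range_compRight_inclUE (d := s - s') fun v => by
    rw [LinearMap.sub_apply, map_sub, hs, hs', sub_self]
  have ht' (v) : inclUE ℓ G (t v) = s v - s' v := LinearMap.congr_fun ht v
  refine H1.mk_eq_mk.2 ⟨t, fun σ => LinearMap.ext fun v => inclUE_injective ?_⟩
  rw [LinearMap.sub_apply, LinearMap.sub_apply, repHomVU_apply, map_sub, map_sub, hz, hz',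
    ← augRep_inclUE, ht', ht', map_sub]
  abel

variable [IsTopologicalGroup G]

theorem inflation_injective : Function.Injective (inflation ℓ G) :=
  H1.map_injective (QuotientGroup.mk'_surjective _) Function.injective_id
    ⟨1, fun m _ => ⟨m, rfl⟩⟩

theorem isJohnsonClass_unique {j j' : H1 (repAOut ℓ G)} (hj : IsJohnsonClass ℓ G j)
    (hj' : IsJohnsonClass ℓ G j') : j = j' := by
  obtain ⟨c, hc, h⟩ := hj
  obtain ⟨c', hc', h'⟩ := hj'
  rw [isModifiedDiagonalClass_unique hc' hc] at h'
  exact inflation_injective (h.trans h'.symm)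

theorem IsSectionCocycle.apply_conj {s : V ℓ G →ₗ[ℤ_[ℓ]] E ℓ G} {z : Z1 (repHomVU ℓ G)}
    (hz : IsSectionCocycle s z) (hs : ∀ v, projEV ℓ G (s v) = v) (g : G) :
    z.1 (conj g) = commutatorMap ℓ G (groupToV ℓ (.ofMul g)) := by
  refine LinearMap.ext fun v => inclUE_injective ?_
  rw [hz, ← map_inv, augRep_conj 1, augRep_conj_sub, hs]

theorem exists_isJohnsonClass {c : H1 (repHomVU ℓ G)} (hc : IsModifiedDiagonalClass ℓ G c) :
    ∃ j, IsJohnsonClass ℓ G j := by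
  obtain ⟨s, z, hs, hz, hzc⟩ := hc
  have hq : Continuous (LinearMap.range (commutatorMap ℓ G)).mkQ := continuous_quot_mk
  obtain ⟨j, hj⟩ := H1.exists_inflation_eq_map (ρ' := repA ℓ G) (Inn G) hq (fun _ _ => rfl) z <| by
    rintro _ ⟨g, rfl⟩
    rw [IsSectionCocycle.apply_conj hz hs]
    exact (Submodule.Quotient.mk_eq_zero _).2 ⟨_, rfl⟩
  exact ⟨j, c, ⟨s, z, hs, hz, hzc⟩, hzc ▸ hj⟩

variable [CompactSpace G] [TopologicallyFG G]

theorem exists_isSectionCocycle {s : V ℓ G →ₗ[ℤ_[ℓ]] E ℓ G} (hs : ∀ v, projEV ℓ G (s v) = v) :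
    ∃ z : Z1 (repHomVU ℓ G), IsSectionCocycle s z := by
  obtain ⟨z, hz⟩ := Z1.exists_lift (ρ := repHomVU ℓ G)
    (ρ' := (augRep ℓ G 1 2).linHom (augRep ℓ G 1 3))
    (isInducing_compRight (isInducing_linearMap_of_injective inclUE_injective))
    compRight_inclUE_injective
    (fun σ t => LinearMap.ext fun v => (augRep_inclUE σ (t (augRep ℓ G 1 2 σ⁻¹ v))).symm)
    (Z1.coboundary _ s (continuous_linHom_augRep_apply s)) fun σ =>
      mem_range_compRight_inclUE fun v => by
        change projEV ℓ G (augRep ℓ G 1 3 σ (s (augRep ℓ G 1 2 σ⁻¹ v)) - s v) = 0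
        rw [map_sub, projEV_augRep, hs, hs, Representation.self_inv_apply, sub_self]
  exact ⟨z, fun σ v => LinearMap.congr_fun (hz σ) v⟩

theorem exists_isModifiedDiagonalClass [Module.Free ℤ_[ℓ] (V ℓ G)] :
    ∃ c, IsModifiedDiagonalClass ℓ G c := by
  obtain ⟨s, hs⟩ := Module.projective_lifting_property (projEV ℓ G) LinearMap.id projEV_surjective
  have hs' (v) : projEV ℓ G (s v) = v := LinearMap.congr_fun hs v
  obtain ⟨z, hz⟩ := exists_isSectionCocycle hs'
  exact ⟨_, s, z, hs', hz, rfl⟩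

end Classes

/-! ### An automorphism acting by inversion -/

section Inversion

variable {ℓ : ℕ} [Fact ℓ.Prime] {G : Type u} [Group G] [TopologicalSpace G] [IsTopologicalGroup G]

/-- `σ` acts on the topological abelianization of `G` by inversion, that is, as multiplication by
`-1` in additive notation. -/
def ActsByInversion (σ : ContAut G) : Prop :=
  ∀ g : G, ((σ g : G) : TopologicalAbelianization G) = ((g : G) : TopologicalAbelianization G)⁻¹

theorem ContAut.map_mem_closure_commutator (τ : ContAut G) {c : G}
    (hc : c ∈ (commutator G).topologicalClosure) : τ c ∈ (commutator G).topologicalClosure := by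
  have hle : commutator G ≤ (commutator G).topologicalClosure.comap (τ : G →* G) :=
    Subgroup.commutator_le.2 fun a _ b _ => by
      rw [Subgroup.mem_comap, map_commutatorElement]
      exact Subgroup.le_topologicalClosure _
        (Subgroup.commutator_mem_commutator (Subgroup.mem_top _) (Subgroup.mem_top _))
  exact Subgroup.topologicalClosure_minimal _ hle
    ((Subgroup.isClosed_topologicalClosure _).preimage τ.continuous) hc

theorem ActsByInversion.conjugate {σ : ContAut G} (hσ : ActsByInversion σ) (τ : ContAut G) :
    ActsByInversion (τ * σ * τ⁻¹) := fun g => by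
  have h : (σ (τ⁻¹ g))⁻¹ * (τ⁻¹ g)⁻¹ ∈ (commutator G).topologicalClosure :=
    QuotientGroup.eq.1 (hσ (τ⁻¹ g))
  have hτ := τ.map_mem_closure_commutator h
  rw [map_mul, map_inv, map_inv, ContAut.apply_inv_apply] at hτ
  exact QuotientGroup.eq.2 hτ

variable [CompactSpace G] [TopologicallyFG G] {σ : ContAut G}

theorem ActsByInversion.augRep_V_eq_neg (hσ : ActsByInversion σ) (v : V ℓ G) :
    augRep ℓ G 1 2 σ v = -v := by
  obtain ⟨g, rfl⟩ := groupToV_surjective v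
  exact (augRep_groupToV σ _).trans
    ((groupToV_congr (h := g.toMul⁻¹) (hσ g.toMul)).trans (map_neg (groupToV ℓ) g))

theorem ActsByInversion.augRep_U_eq_self (hσ : ActsByInversion σ) (u : U ℓ G) :
    augRep ℓ G 2 3 σ u = u := by
  obtain ⟨t, rfl⟩ := mulTensor_surjective u
  induction t using TensorProduct.induction_on with
  | zero => simp
  | tmul x y => simp [mulTensor, augRep_mulV, hσ.augRep_V_eq_neg]
  | add a b ha hb => rw [map_add, map_add, ha, hb]

theorem ActsByInversion.augRep_V_inv_eq_neg (hσ : ActsByInversion σ) (v : V ℓ G) :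
    augRep ℓ G 1 2 σ⁻¹ v = -v := by
  rw [← neg_eq_iff_eq_neg, ← hσ.augRep_V_eq_neg, Representation.self_inv_apply]

theorem ActsByInversion.repHomVU_eq_neg (hσ : ActsByInversion σ) (f : HomVU ℓ G) :
    repHomVU ℓ G σ f = -f := LinearMap.ext fun v => by
  rw [repHomVU_apply, hσ.augRep_U_eq_self, hσ.augRep_V_inv_eq_neg, map_neg, LinearMap.neg_apply]

theorem ActsByInversion.repA_eq_neg (hσ : ActsByInversion σ) (a : A ℓ G) :
    repA ℓ G σ a = -a := by
  obtain ⟨f, rfl⟩ := Submodule.Quotient.mk_surjective _ a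
  exact congrArg Submodule.Quotient.mk (hσ.repHomVU_eq_neg f)

theorem ActsByInversion.augRep_E_sub_mem_map (hσ : ActsByInversion σ) {τ : ContAut G}
    (hτ : ActsByInversion τ) (e : E ℓ G) :
    augRep ℓ G 1 3 σ e - augRep ℓ G 1 3 τ e ∈ (W ℓ G).map (inclUE ℓ G) := by
  obtain ⟨g, hg⟩ := groupToV_surjective (projEV ℓ G e)
  let x := AugQuot.mk ℓ G 1 3 ⟨_, of_sub_one_mem_pow_one ℓ g.toMul⟩
  obtain ⟨u, hu⟩ := mem_range_inclUE (e := e - x) (by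
    rw [map_sub, projEV_mk, ← hg, sub_eq_zero]
    rfl)
  have hw : of ℓ (σ g.toMul) - of ℓ (τ g.toMul) ∈ preimageW ℓ G :=
    of_sub_of_mem_preimageW ((hσ _).trans (hτ _).symm)
  refine ⟨_, (mem_preimageW (preimageW_le hw)).1 hw, ?_⟩
  rw [← sub_add_cancel e x, ← hu, map_add, map_add, augRep_inclUE, augRep_inclUE,
    hσ.augRep_U_eq_self, hτ.augRep_U_eq_self, add_sub_add_left_eq_sub, augRep_mk_of_sub_one,
    augRep_mk_of_sub_one, inclUE_mk, ← map_sub (AugQuot.mk ℓ G 1 3)]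
  exact congrArg (AugQuot.mk ℓ G 1 3) (Subtype.ext (sub_sub_sub_cancel_right _ _ _).symm)

theorem IsSectionCocycle.apply_sub_mem_range {s : V ℓ G →ₗ[ℤ_[ℓ]] E ℓ G}
    {z : Z1 (repHomVU ℓ G)} (hz : IsSectionCocycle s z) {τ : ContAut G} (hτ : ActsByInversion τ)
    (hσ : ActsByInversion σ) : z.1 τ - z.1 σ ∈ LinearMap.range (inclHom ℓ G) := by
  refine mem_range_inclHom.2 fun v => ?_
  obtain ⟨w, hw, hwe⟩ := hτ.augRep_E_sub_mem_map hσ (s (-v))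
  have key : (z.1 τ - z.1 σ) v = w := inclUE_injective <| by
    rw [LinearMap.sub_apply, map_sub, hz, hz, hτ.augRep_V_inv_eq_neg, hσ.augRep_V_inv_eq_neg,
      sub_sub_sub_cancel_right, hwe]
  exact key ▸ hw

theorem ActsByInversion.exists_coeffMapAut_mk_eq (hσ : ActsByInversion σ)
    {c : H1 (repHomVU ℓ G)} (hc : IsModifiedDiagonalClass ℓ G c) :
    ∃ y : Z1 (repHomVW ℓ G), coeffMapAut ℓ G (H1.mk y) = 2 • c ∧
      ∀ g, y.1 (conj g) ∈ LinearMap.range (commutatorMapW ℓ G) := by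
  obtain ⟨s, z, hs, hz, rfl⟩ := hc
  let b := Z1.coboundary (repHomVU ℓ G) (z.1 σ) (continuous_linHom_augRep_apply _)
  obtain ⟨y, hy⟩ := Z1.exists_lift isInducing_inclHom inclHom_injective inclHom_rep (2 • z + b)
    fun τ => by
      change 2 • z.1 τ + (repHomVU ℓ G τ (z.1 σ) - z.1 σ) ∈ _
      rw [Z1.two_nsmul_add_coboundary_of_neg z hσ.repHomVU_eq_neg]
      exact IsSectionCocycle.apply_sub_mem_range hz (hσ.conjugate τ) hσ
  refine ⟨y, ?_, fun g => ⟨2 • groupToV ℓ (.ofMul g), inclHom_injective ?_⟩⟩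
  · calc coeffMapAut ℓ G (H1.mk y) = H1.mk (2 • z + b) :=
          congrArg H1.mk (Subtype.ext (funext hy))
      _ = 2 • H1.mk z := by
          rw [map_add, map_nsmul, show H1.mk b = 0 from H1.mk_coboundary, add_zero]
  · have hb : b.1 (conj g) = 0 := sub_eq_zero.2 (repHomVU_inner ⟨conj g, g, rfl⟩ _)
    rw [hy, inclHom_commutatorMapW, map_nsmul, ← IsSectionCocycle.apply_conj hz hs]
    exact (congrArg (2 • z.1 (conj g) + ·) hb).trans (add_zero _) |>.symm

theorem ActsByInversion.exists_coeffMapOut_eq (hσ : ActsByInversion σ) {j : H1 (repAOut ℓ G)}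
    (hj : IsJohnsonClass ℓ G j) : ∃ y, coeffMapOut ℓ G y = 2 • j := by
  obtain ⟨c, hc, hjc⟩ := hj
  obtain ⟨y, hyc, hy⟩ := hσ.exists_coeffMapAut_mk_eq hc
  have hq : Continuous (LinearMap.range (commutatorMapW ℓ G)).mkQ := continuous_quot_mk
  obtain ⟨x, hx⟩ := H1.exists_inflation_eq_map (ρ' := repAW ℓ G) (Inn G) hq (fun _ _ => rfl) y <| by
    rintro _ ⟨g, rfl⟩
    exact (Submodule.Quotient.mk_eq_zero _).2 (hy g)
  refine ⟨x, inflation_injective ?_⟩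
  obtain ⟨x, rfl⟩ := H1.mk_surjective x
  calc inflation ℓ G (coeffMapOut ℓ G (H1.mk x))
      = toAAut ℓ G (coeffMapAut ℓ G (H1.mk y)) :=
        congrArg (H1.map (repAW ℓ G) (repA ℓ G) (MonoidHom.id _) continuous_id (inclA ℓ G)
          continuous_inclA inclA_rep) hx
    _ = inflation ℓ G (2 • j) := by rw [hyc, map_nsmul, map_nsmul, hjc]

variable [Module.Free ℤ_[ℓ] (V ℓ G)]

theorem ActsByInversion.coeffMapAut_injective (hσ : ActsByInversion σ) :
    Function.Injective (coeffMapAut ℓ G) :=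
  H1.map_injective_of_neg inclHom_injective hσ.repHomVU_eq_neg fun _ =>
    mem_range_inclHom_of_two_smul_mem

theorem ActsByInversion.coeffMapOut_injective (hσ : ActsByInversion σ) :
    Function.Injective (coeffMapOut ℓ G) :=
  H1.map_injective_of_neg (σ := (σ : ContOut G)) inclA_injective hσ.repA_eq_neg fun _ =>
    mem_range_inclA_of_two_smul_mem

theorem ActsByInversion.existsUnique_coeffMapAut_eq (hσ : ActsByInversion σ)
    {c : H1 (repHomVU ℓ G)} (hc : IsModifiedDiagonalClass ℓ G c) :
    ∃! x, coeffMapAut ℓ G x = 2 • c := by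
  obtain ⟨y, hy, -⟩ := hσ.exists_coeffMapAut_mk_eq hc
  exact ⟨_, hy, fun x hx => hσ.coeffMapAut_injective (hx.trans hy.symm)⟩

theorem ActsByInversion.existsUnique_coeffMapOut_eq (hσ : ActsByInversion σ)
    {j : H1 (repAOut ℓ G)} (hj : IsJohnsonClass ℓ G j) : ∃! y, coeffMapOut ℓ G y = 2 • j := by
  obtain ⟨y, hy⟩ := hσ.exists_coeffMapOut_eq hj
  exact ⟨y, hy, fun x hx => hσ.coeffMapOut_injective (hx.trans hy.symm)⟩

end Inversion

end ProEll

theorem mainTheorem9_general (ℓ : ℕ) [Fact ℓ.Prime]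
    (G : Type u) [Group G] [TopologicalSpace G] [IsTopologicalGroup G] [CompactSpace G]
    (hfg : ∃ S : Finset G, (Subgroup.closure (S : Set G)).topologicalClosure = ⊤)
    [Module.IsTorsionFree ℤ_[ℓ] (ProEll.V ℓ G)] :
    (∃! c, ProEll.IsModifiedDiagonalClass ℓ G c) ∧
    (∃! j, ProEll.IsJohnsonClass ℓ G j) ∧
    ((∃ σ : ProEll.ContAut G, ∀ g : G,
        ((σ g : G) : TopologicalAbelianization G) = ((g : G) : TopologicalAbelianization G)⁻¹) →
      (∀ c, ProEll.IsModifiedDiagonalClass ℓ G c → ∃! x, ProEll.coeffMapAut ℓ G x = 2 • c) ∧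
      (∀ j, ProEll.IsJohnsonClass ℓ G j → ∃! y, ProEll.coeffMapOut ℓ G y = 2 • j)) := by
  have : ProEll.TopologicallyFG G := ⟨hfg⟩
  have : Module.Free ℤ_[ℓ] (ProEll.V ℓ G) := inferInstance
  obtain ⟨c, hc⟩ := ProEll.exists_isModifiedDiagonalClass (ℓ := ℓ) (G := G)
  obtain ⟨j, hj⟩ := ProEll.exists_isJohnsonClass hc
  refine ⟨⟨c, hc, fun c' hc' => ProEll.isModifiedDiagonalClass_unique hc' hc⟩,
    ⟨j, hj, fun j' hj' => ProEll.isJohnsonClass_unique hj' hj⟩, ?_⟩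
  rintro ⟨σ, hσ : ProEll.ActsByInversion σ⟩
  exact ⟨fun _ => hσ.existsUnique_coeffMapAut_eq, fun _ => hσ.existsUnique_coeffMapOut_eq⟩

theorem mainTheorem9 (ℓ : ℕ) [Fact ℓ.Prime]
    (G : Type u) [Group G] [TopologicalSpace G] [IsTopologicalGroup G]
    [CompactSpace G] [T2Space G] [TotallyDisconnectedSpace G]
    (hproEll : ∀ N : OpenNormalSubgroup G, IsPGroup ℓ (G ⧸ N.toSubgroup))
    (hfg : ∃ S : Finset G, (Subgroup.closure (S : Set G)).topologicalClosure = ⊤)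
    (htf : IsMulTorsionFree (TopologicalAbelianization G)) :
    (∃! c, ProEll.IsModifiedDiagonalClass ℓ G c) ∧
    (∃! j, ProEll.IsJohnsonClass ℓ G j) ∧
    ((∃ σ : ProEll.ContAut G, ∀ g : G,
        ((σ g : G) : TopologicalAbelianization G) = ((g : G) : TopologicalAbelianization G)⁻¹) →
      (∀ c, ProEll.IsModifiedDiagonalClass ℓ G c →
        (∃ x, ProEll.coeffMapAut ℓ G x = 4 • c) ∧
        (ProEll.H0ModTwoVanishes ℓ (ProEll.repHomVU ℓ G) →
          ∃! x, ProEll.coeffMapAut ℓ G x = 2 • c)) ∧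
      (∀ j, ProEll.IsJohnsonClass ℓ G j →
        (∃ y, ProEll.coeffMapOut ℓ G y = 4 • j) ∧
        (ProEll.H0ModTwoVanishes ℓ (ProEll.repHomVUOut ℓ G) →
          ∃! y, ProEll.coeffMapOut ℓ G y = 2 • j))) := by
  have : ProEll.TopologicallyFG G := ⟨hfg⟩
  have := ProEll.isTorsionFree_V hproEll htf
  obtain ⟨hMD, hJ, h⟩ := mainTheorem9_general ℓ G hfg
  refine ⟨hMD, hJ, fun hσ => ⟨fun c hc => ?_, fun j hj => ?_⟩⟩
  · obtain ⟨x, hx, hunique⟩ := (h hσ).1 c hc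
    exact ⟨⟨2 • x, by rw [map_nsmul, hx, ← mul_nsmul]⟩, fun _ => ⟨x, hx, hunique⟩⟩
  · obtain ⟨y, hy, hunique⟩ := (h hσ).2 j hj
    exact ⟨⟨2 • y, by rw [map_nsmul, hy, ← mul_nsmul]⟩, fun _ => ⟨y, hy, hunique⟩⟩
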